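/- Let $\mathbb{N}^*\cup\{0\}=\{0,1,2,\dots\}\cup\{\infty\}$ be the one-point compactification of the discrete space $\{0,1,2,\dots\}$, let $X=\prod_{n=0}^{\infty}(\mathbb{N}^*\cup\{0\})$ with the product topology, and let $X_0=\{(a_n)_{n\ge0}\in X:\ \sum_{n=0}^{\infty}a_n=\infty\}$ with the subspace topology. Define a relation $E_\Sigma$ on $X$ by: $(a_n)_{n\ge0}\,E_\Sigma\,(b_n)_{n\ge0}$ if and only if there is an integer $k\ge 0$ such that for all integers $l\ge 0$ and $n\ge 0$ $$\sum_{i=0}^{l}a_{n+i}\le\sum_{j=-k}^{l+k}b_{n+j}\qquad\text{and}\qquad \sum_{i=0}^{l}b_{n+i}\le\sum_{j=-k}^{l+k}a_{n+j},$$ where $a_m=b_m=0$ for $m<0$. Let $E_\Sigma|_{X_0}$ be its restriction to $X_0$. For a separable infinite-dimensional complex Hilbert space $H$, let ${\rm SA}(H)$ be the space of all (possibly unbounded) self-adjoint operators on $H$ with the strong resolvent topology, i.e. the coarsest topology making $A\mapsto (A-i)^{-1}\in\mathbb{B}(H)$ continuous for the strong operator topology, and let $E_{{\rm dom},u}^{{\rm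 SA}(H)}$ be the equivalence relation on ${\rm SA}(H)$ given by: $A\,E_{{\rm dom},u}^{{\rm SA}(H)}\,B$ if and only if there is a unitary $u$ on $H$ with $u\cdot{\rm dom}(A)={\rm dom}(B)$. For equivalence relations $E$ on $Y$ and $F$ on $Z$, write $E\le_B F$ ($E$ is Borel reducible to $F$) if there is a Borel map $f:Y\to Z$ with $x\,E\,y\Leftrightarrow f(x)\,F\,f(y)$ for all $x,y\in Y$, and $E\sim_B F$ if $E\le_B F$ and $F\le_B E$. An equivalence relation on $Y$ is $K_\sigma$ if, as a subset of $Y\times Y$, it is a countable union of compact sets. **Proposition 3.8.** $E_\Sigma$ is a $K_\sigma$ equivalence relation on $X$, and $E_\Sigma|_{X_0}\le_B E_\Sigma$. For every separable infinite-dimensional complex Hilbert space $H$, $$E_{{\rm dom},u}^{{\rm SA}(H)}\sim_B E_\Sigma|_{X_0}\quad\text{and}\quad E_{{\rm dom},u}^{{\rm SA}(H)}\le_B E_\Sigma .$$ In particular, $E_{{\rm dom},u}^{{\rm SA}(H)}$ is Borel reducible to a $K_\sigma$ equivalence relation on a Polish space. -/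

import Mathlib

open Complex

section SelfAdjointOperators

variable (H : Type*) [NormedAddCommGroup H] [InnerProductSpace ℂ H] [CompleteSpace H]

/-- `SA(H)`: the set of all (not necessarily bounded) self-adjoint operators on `H`, i.e. partially
defined linear operators with `A† = A`.  Such operators are automatically densely defined
(`IsSelfAdjoint.dense_domain`). -/
def SA : Type _ := {A : H →ₗ.[ℂ] H // IsSelfAdjoint A}

variable {H}

namespace SA

/-- The domain `dom A` of a self-adjoint operator. -/
def dom (A : SA H) : Submodule ℂ H := A.1.domain

/-- The map `A - i : dom A → H`. -/
noncomputable def subI (A : SA H) : A.dom →ₗ[ℂ] H :=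
  (show A.dom →ₗ[ℂ] H from A.1.toFun) - I • A.dom.subtype

theorem subI_apply (A : SA H) (x : A.dom) : A.subI x = A.1 x - I • (x : H) := rfl

theorem symm (A : SA H) (x y : A.dom) :
    inner ℂ (A.1 x) (y : H) = inner ℂ (x : H) (A.1 y) := by
  have h := LinearPMap.adjoint_isFormalAdjoint A.2.dense_domain
  rw [LinearPMap.isSelfAdjoint_def.1 A.2] at h
  exact h x y

theorem inner_im (A : SA H) (x : A.dom) : (inner ℂ (A.1 x) (x : H)).im = 0 := by
  have h := congrArg Complex.im (inner_conj_symm (𝕜 := ℂ) (A.1 x) (x : H))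
  rw [← A.symm x x] at h
  simp only [Complex.conj_im] at h
  linarith

theorem norm_subI_sq (A : SA H) (x : A.dom) :
    ‖A.subI x‖ ^ 2 = ‖A.1 x‖ ^ 2 + ‖(x : H)‖ ^ 2 := by
  have h1 := A.inner_im x
  rw [subI_apply, norm_sub_sq (𝕜 := ℂ), inner_smul_right, norm_smul]
  simp [h1]

theorem norm_le_norm_subI (A : SA H) (x : A.dom) : ‖(x : H)‖ ≤ ‖A.subI x‖ := by
  have h := A.norm_subI_sq x
  exact le_of_sq_le_sq (by nlinarith [sq_nonneg ‖A.1 x‖]) (norm_nonneg _)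

theorem norm_apply_le_norm_subI (A : SA H) (x : A.dom) : ‖A.1 x‖ ≤ ‖A.subI x‖ := by
  have h := A.norm_subI_sq x
  exact le_of_sq_le_sq (by nlinarith [sq_nonneg ‖(x : H)‖]) (norm_nonneg _)

theorem subI_injective (A : SA H) : Function.Injective A.subI := by
  rw [injective_iff_map_eq_zero]
  intro x hx
  have h := A.norm_le_norm_subI x
  rw [hx, norm_zero] at h
  exact Subtype.ext (norm_le_zero_iff.1 h)

theorem isClosed_range_subI (A : SA H) : IsClosed (Set.range A.subI) := by
  have hcl : IsClosed (A.1.graph : Set (H × H)) := A.2.isClosed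
  have : CompleteSpace A.1.graph := hcl.completeSpace_coe
  let Φ : A.1.graph →L[ℂ] H :=
    ((ContinuousLinearMap.snd ℂ H H) - I • (ContinuousLinearMap.fst ℂ H H)).comp
      A.1.graph.subtypeL
  have hΦ : ∀ x : A.dom, ∀ hx, Φ ⟨((x : H), A.1 x), hx⟩ = A.subI x := fun x hx => rfl
  have hanti : AntilipschitzWith 1 Φ := by
    refine ContinuousLinearMap.antilipschitz_of_bound Φ ?_
    rintro ⟨⟨a, b⟩, hab⟩
    obtain ⟨x, rfl, rfl⟩ := (LinearPMap.mem_graph_iff _).1 hab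
    rw [hΦ x]
    simp only [NNReal.coe_one, one_mul]
    exact max_le (A.norm_le_norm_subI x) (A.norm_apply_le_norm_subI x)
  have hrange : Set.range A.subI = Set.range Φ := by
    ext y
    constructor
    · rintro ⟨x, rfl⟩
      exact ⟨⟨((x : H), A.1 x), A.1.mem_graph x⟩, rfl⟩
    · rintro ⟨⟨⟨a, b⟩, hab⟩, rfl⟩
      obtain ⟨x, rfl, rfl⟩ := (LinearPMap.mem_graph_iff _).1 hab
      exact ⟨x, (hΦ x hab).symm⟩
  rw [hrange]
  exact hanti.isClosed_range Φ.uniformContinuous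

theorem orthogonal_range_subI (A : SA H) : (LinearMap.range A.subI)ᗮ = ⊥ := by
  rw [Submodule.eq_bot_iff]
  intro y hy
  have h1 : ∀ x : A.dom, inner ℂ (-I • y) (x : H) = inner ℂ y (A.1 x) := by
    intro x
    have h := (Submodule.mem_orthogonal' _ _).1 hy _ (LinearMap.mem_range_self A.subI x)
    rw [subI_apply, inner_sub_right, inner_smul_right, sub_eq_zero] at h
    rw [h, inner_smul_left]
    simp
  have hadj := LinearPMap.isSelfAdjoint_def.1 A.2
  have hy1 : y ∈ A.1.adjoint.domain := A.1.mem_adjoint_domain_of_exists y ⟨_, h1⟩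
  have hy2 : y ∈ A.dom := by rw [hadj] at hy1; exact hy1
  have h3 := A.symm ⟨y, hy2⟩ ⟨y, hy2⟩
  have h2 := h1 ⟨y, hy2⟩
  rw [← h3, inner_smul_left] at h2
  have h4 := congrArg Complex.im h2
  rw [A.inner_im] at h4
  simp only [inner_self_eq_norm_sq_to_K] at h4
  simpa [← Complex.ofReal_pow] using h4

theorem subI_bijective (A : SA H) : Function.Bijective A.subI := by
  refine ⟨A.subI_injective, LinearMap.range_eq_top.1 ?_⟩
  have hcl : IsClosed (LinearMap.range A.subI : Set H) := by
    rw [LinearMap.coe_range]; exact A.isClosed_range_subI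
  rw [← hcl.submodule_topologicalClosure_eq, Submodule.topologicalClosure_eq_top_iff]
  exact A.orthogonal_range_subI

/-- The resolvent `(A - i)⁻¹ ∈ 𝔹(H)`. -/
noncomputable def resolvent (A : SA H) : H →L[ℂ] H :=
  (A.dom.subtype ∘ₗ (LinearEquiv.ofBijective A.subI A.subI_bijective).symm.toLinearMap).mkContinuous
    1 (fun ξ => by
      obtain ⟨x, rfl⟩ := A.subI_bijective.2 ξ
      have h : (LinearEquiv.ofBijective A.subI A.subI_bijective).symm (A.subI x) = x :=
        (LinearEquiv.ofBijective A.subI A.subI_bijective).symm_apply_apply x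
      simpa [h] using A.norm_le_norm_subI x)

/-- The strong resolvent topology on `SA(H)`: the coarsest topology for which `A ↦ (A - i)⁻¹` is
continuous into the bounded operators with the strong operator topology (the topology of pointwise
convergence on `H`). -/
noncomputable instance : TopologicalSpace (SA H) :=
  TopologicalSpace.induced
    (fun A : SA H => (ContinuousLinearMap.toPointwiseConvergenceCLM ℂ (RingHom.id ℂ) H H)
      A.resolvent)
    inferInstance

end SA

variable (H) in
/-- Unitary equivalence of domains: there is a unitary `u` of `H` with `u · dom A = dom B`. -/
def EDomU (A B : SA H) : Prop :=
  ∃ u : unitary (H →L[ℂ] H), (u : H →L[ℂ] H) '' (A.dom : Set H) = (B.dom : Set H)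

end SelfAdjointOperators

section BorelReducibility

/-- The relation `E` on `X` is Borel reducible to the relation `F` on `Y`: there is a map `f : X → Y`,
Borel with respect to the Borel σ-algebras of the topologies, with `x E y ↔ f x F f y`. -/
def BorelReducible {X Y : Type*} [TopologicalSpace X] [TopologicalSpace Y]
    (E : X → X → Prop) (F : Y → Y → Prop) : Prop :=
  ∃ f : X → Y, @Measurable X Y (borel X) (borel Y) f ∧ ∀ x y, E x y ↔ F (f x) (f y)

/-- Borel bireducibility. -/
def BorelBireducible {X Y : Type*} [TopologicalSpace X] [TopologicalSpace Y]
    (E : X → X → Prop) (F : Y → Y → Prop) : Prop :=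
  BorelReducible E F ∧ BorelReducible F E

/-- `E` is a `K_σ` equivalence relation on `X`: an equivalence relation which, as a subset of
`X × X`, is a countable union of compact sets. -/
def IsKSigmaEquivalence {X : Type*} [TopologicalSpace X] (E : X → X → Prop) : Prop :=
  Equivalence E ∧ IsSigmaCompact {p : X × X | E p.1 p.2}

end BorelReducibility

section WindowedSums

/-- The space `X = ∏_{n ≥ 0} {0, 1, 2, …, ∞}` with the product topology, where `{0, 1, 2, …, ∞}`
carries the topology of the one-point compactification of the discrete space `{0, 1, 2, …}`. -/
abbrev SeqX : Type := ℕ → ℕ∞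

/-- Extension of a sequence by `0` to negative indices. -/
def SeqX.ext (a : SeqX) (m : ℤ) : ℕ∞ := if 0 ≤ m then a m.toNat else 0

/-- The relation `E_Σ`: for some `k ≥ 0`, every window sum `a_n + ⋯ + a_{n+l}` is at most
`b_{n-k} + ⋯ + b_{n+l+k}`, and vice versa. -/
def ESigma (a b : SeqX) : Prop :=
  ∃ k : ℕ, ∀ l n : ℕ,
    (∑ i ∈ Finset.range (l + 1), a (n + i) ≤
        ∑ j ∈ Finset.Icc (-(k : ℤ)) ((l : ℤ) + k), b.ext ((n : ℤ) + j)) ∧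
      (∑ i ∈ Finset.range (l + 1), b (n + i) ≤
        ∑ j ∈ Finset.Icc (-(k : ℤ)) ((l : ℤ) + k), a.ext ((n : ℤ) + j))

/-- `X₀`: the subspace of the sequences with infinite sum. -/
def SeqX₀ : Set SeqX := {a | ∑' n, a n = ⊤}

/-- The restriction of `E_Σ` to `X₀` (with the subspace topology). -/
def ESigma₀ (a b : SeqX₀) : Prop := ESigma a b

end WindowedSums

/-! The domain of `A` is the range of the contraction R = (A - i)⁻¹, and an operator range is
determined, up to bounded factors, by the dyadic spectral multiplicities of R R*. Split H into the
spectral subspaces of S = R R* for the intervals (2·4⁻⁽ⁿ⁺¹⁾, 2·4⁻ⁿ]. In an orthonormal basis adapted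
to this splitting, ‖R* x‖ is comparable to ‖T x‖, where T is diagonal with entry 2⁻ⁿ on the n-th
piece, and Douglas' lemma gives ran R = ran T. The invariant of `A` is the sequence of dimensions of
the pieces. It lies in X₀ because H is infinite-dimensional.

The core is `HilbertBasis.exists_unitary_image_eq_iff`: two such diagonal ranges are unitarily
equivalent iff their multiplicity sequences are E_Σ-related. If the sequences are related, Hall's
marriage theorem and Schröder–Bernstein match the basis vectors with levels moving by at most k, so
corresponding diagonal entries have bounded ratios. Conversely, equal ranges give bounded W, W' with
T = T' W and T' = T W'. If a window of the first sequence outweighed the enlarged window of the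
second, a dimension count would give a nonzero x spanned by the first window and orthogonal to the
enlarged second one. Its components below and above that window have total norm at most (‖W‖ + ‖W'‖)
2⁻ᵏ ‖x‖, which is absurd for large k.

The invariant is Borel because a dimension is the trace ∑ ‖P eⱼ‖² of a projection, and for the
kernels P of (S - t)⁺ each ‖P x‖ is upper semicontinuous in the strong resolvent topology. In the
other direction, a sequence in X₀ goes to the diagonal operator whose eigenvalues 2ⁿ have the
prescribed multiplicities. Its j-th eigenvalue is locally constant in the sequence, so this map is
continuous. Finally, E_Σ is a countable union of closed subsets of the compact space X × X. -/

set_option linter.unusedSectionVars false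

/-! ### Windowed sums -/

section WindowComparison

/-- Every window sum of `a` is at most the sum of `b` over the window enlarged by `k`. -/
def WindowLE (k : ℕ) (a b : SeqX) : Prop :=
  ∀ n m : ℕ, ∑ i ∈ Finset.Icc n m, a i ≤ ∑ i ∈ Finset.Icc (n - k) (m + k), b i

theorem WindowLE.trans {k k' : ℕ} {a b c : SeqX} (h : WindowLE k a b) (h' : WindowLE k' b c) :
    WindowLE (k + k') a c := by
  intro n m
  refine (h n m).trans ((h' _ _).trans_eq ?_)
  rw [Nat.sub_sub, Nat.add_assoc]

theorem WindowLE.mono {k k' : ℕ} (hk : k ≤ k') {a b : SeqX} (h : WindowLE k a b) :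
    WindowLE k' a b := by
  intro n m
  refine (h n m).trans (Finset.sum_le_sum_of_subset (Finset.Icc_subset_Icc ?_ ?_)) <;> omega

theorem WindowLE.refl (a : SeqX) : WindowLE 0 a a := fun n m => by simp

/-- Extension by zero and truncated subtraction cut a window at 0 in the same way, so integer
indices can be dropped. -/
theorem SeqX.sum_ext (b : SeqX) (k l n : ℕ) :
    ∑ j ∈ Finset.Icc (-(k : ℤ)) ((l : ℤ) + k), b.ext ((n : ℤ) + j) =
      ∑ i ∈ Finset.Icc (n - k) (n + l + k), b i := by
  symm
  refine Finset.sum_of_injOn (fun m : ℕ => (m : ℤ) - n) ?_ ?_ ?_ ?_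
  · intro x _ y _ h
    simpa using h
  · intro x hx
    simp only [Finset.coe_Icc, Set.mem_Icc] at hx ⊢
    omega
  · intro j hj hj'
    rw [Finset.mem_Icc] at hj
    rw [SeqX.ext, if_neg]
    intro h0
    refine hj' ⟨((n : ℤ) + j).toNat, ?_, ?_⟩
    · simp only [Finset.coe_Icc, Set.mem_Icc]
      omega
    · simp only
      omega
  · intro i _
    simp [SeqX.ext]

theorem SeqX.sum_range_add (a : SeqX) (l n : ℕ) :
    ∑ i ∈ Finset.range (l + 1), a (n + i) = ∑ i ∈ Finset.Icc n (n + l), a i := by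
  have h := Finset.sum_Ico_eq_sum_range a n (n + l + 1)
  rw [show n + l + 1 - n = l + 1 by omega] at h
  rw [← h]
  rfl

theorem esigma_iff {a b : SeqX} : ESigma a b ↔ ∃ k, WindowLE k a b ∧ WindowLE k b a := by
  simp only [ESigma, SeqX.sum_ext, SeqX.sum_range_add, WindowLE]
  refine exists_congr fun k => ⟨fun h => ⟨fun n m => ?_, fun n m => ?_⟩, fun h l n =>
    ⟨h.1 n (n + l), h.2 n (n + l)⟩⟩
  all_goals
    rcases le_or_gt n m with hnm | hnm
    · obtain ⟨l, rfl⟩ := Nat.exists_eq_add_of_le hnm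
      first | exact (h l n).1 | exact (h l n).2
    · rw [Finset.Icc_eq_empty (by omega), Finset.sum_empty]
      exact zero_le

theorem esigma_equivalence : Equivalence ESigma where
  refl a := esigma_iff.2 ⟨0, WindowLE.refl a, WindowLE.refl a⟩
  symm h := by
    obtain ⟨k, h1, h2⟩ := esigma_iff.1 h
    exact esigma_iff.2 ⟨k, h2, h1⟩
  trans h h' := by
    obtain ⟨k, h1, h2⟩ := esigma_iff.1 h
    obtain ⟨k', h1', h2'⟩ := esigma_iff.1 h'
    exact esigma_iff.2 ⟨k + k', h1.trans h1', (h2'.trans h2).mono (by omega)⟩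

theorem isClosed_windowLE (k : ℕ) : IsClosed {p : SeqX × SeqX | WindowLE k p.1 p.2} := by
  simp only [WindowLE, Set.ofPred_forall]
  refine isClosed_iInter fun n => isClosed_iInter fun m => isClosed_le ?_ ?_ <;> fun_prop

theorem isKSigmaEquivalence_esigma : IsKSigmaEquivalence ESigma := by
  refine ⟨esigma_equivalence, ?_⟩
  have : {p : SeqX × SeqX | ESigma p.1 p.2} =
      ⋃ k, {p | WindowLE k p.1 p.2} ∩ Prod.swap ⁻¹' {p | WindowLE k p.1 p.2} := by
    ext p
    simp [esigma_iff]
  rw [this]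
  exact isSigmaCompact_iUnion_of_isCompact _ fun k =>
    ((isClosed_windowLE k).inter ((isClosed_windowLE k).preimage continuous_swap)).isCompact

end WindowComparison

/-! ### Matching index sets by levels -/

section Matching

/-- The sequence of the cardinalities of the fibres of a level function. -/
noncomputable def fiberCard {ι : Type*} (lev : ι → ℕ) : SeqX := fun n => (lev ⁻¹' {n}).encard

theorem sum_fiberCard {ι : Type*} (lev : ι → ℕ) (s : Finset ℕ) :
    ∑ n ∈ s, fiberCard lev n = (lev ⁻¹' s).encard := by
  induction s using Finset.induction_on with
  | empty => simp
  | insert n s hn ih =>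
    rw [Finset.sum_insert hn, ih, Finset.coe_insert, Set.insert_eq, Set.preimage_union,
      Set.encard_union_eq]
    · rfl
    · refine Disjoint.preimage _ ?_
      simpa using hn

/-- This is Hall's condition for arbitrary finite sets of levels, not only intervals. If the
k-neighbourhood of `s` fills its hull, the window inequality for the hull suffices. Otherwise a
missing point splits `s` into two smaller parts whose neighbourhoods are disjoint, and the
inequalities add up. -/
theorem WindowLE.sum_le_sum_biUnion {k : ℕ} {a b : SeqX} (h : WindowLE k a b) (s : Finset ℕ) :
    ∑ n ∈ s, a n ≤ ∑ n ∈ s.biUnion fun n => Finset.Icc (n - k) (n + k), b n := by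
  induction s using Finset.strongInduction with
  | H s ih =>
  rcases s.eq_empty_or_nonempty with rfl | hs
  · simp
  set N : Finset ℕ → Finset ℕ := fun s => s.biUnion fun n => Finset.Icc (n - k) (n + k) with hN
  by_cases hcov : Finset.Icc (s.min' hs - k) (s.max' hs + k) ⊆ N s
  · calc ∑ n ∈ s, a n ≤ ∑ n ∈ Finset.Icc (s.min' hs) (s.max' hs), a n :=
          Finset.sum_le_sum_of_subset fun n hn =>
            Finset.mem_Icc.2 ⟨s.min'_le n hn, s.le_max' n hn⟩
      _ ≤ _ := h _ _
      _ ≤ _ := Finset.sum_le_sum_of_subset hcov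
  obtain ⟨m, hm, hmN⟩ := Finset.not_subset.1 hcov
  rw [Finset.mem_Icc] at hm
  have hmN' : ∀ n ∈ s, n + k < m ∨ m + k < n := by
    intro n hn
    by_contra hcon
    exact hmN (Finset.mem_biUnion.2 ⟨n, hn, Finset.mem_Icc.2 (by omega)⟩)
  have hmin := hmN' _ (s.min'_mem hs)
  have hmax := hmN' _ (s.max'_mem hs)
  have h1 : s.filter (· < m) ⊂ s := Finset.filter_ssubset.2 ⟨_, s.max'_mem hs, by omega⟩
  have h2 : s.filter (¬ · < m) ⊂ s := Finset.filter_ssubset.2 ⟨_, s.min'_mem hs, by omega⟩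
  rw [← Finset.sum_filter_add_sum_filter_not s (· < m)]
  refine (add_le_add (ih _ h1) (ih _ h2)).trans ?_
  rw [← Finset.sum_union]
  · refine Finset.sum_le_sum_of_subset (Finset.union_subset ?_ ?_) <;>
      exact Finset.biUnion_subset_biUnion_of_subset_left _ (Finset.filter_subset _ _)
  · rw [Finset.disjoint_left]
    intro x hx hx'
    simp only [Finset.mem_biUnion, Finset.mem_filter, Finset.mem_Icc] at hx hx'
    obtain ⟨p, ⟨hp, hpm⟩, hpx⟩ := hx
    obtain ⟨q, ⟨hq, hqm⟩, hqx⟩ := hx'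
    have := hmN' p hp
    have := hmN' q hq
    omega

/-- Hall's theorem needs finite candidate sets. An index with infinitely many candidates has a whole
infinite fibre within distance `k`, with room for all of the countable `ι`. -/
theorem WindowLE.exists_injective {ι ι' : Type*} [Countable ι] {lev : ι → ℕ} {lev' : ι' → ℕ}
    {k : ℕ} (h : WindowLE k (fiberCard lev) (fiberCard lev')) :
    ∃ f : ι → ι', Function.Injective f ∧ ∀ i, lev i ≤ lev' (f i) + k ∧ lev' (f i) ≤ lev i + k := by
  classical
  set nb : ι → Set ι' := fun i => lev' ⁻¹' (Finset.Icc (lev i - k) (lev i + k)) with hnb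
  let P : ι → Prop := fun i => (nb i).Finite
  -- the indices with finitely many candidates are matched by the marriage theorem
  let t : {i // P i} → Finset ι' := fun i => i.2.toFinset
  have hall : ∀ s : Finset {i // P i}, s.card ≤ (s.biUnion t).card := by
    intro s
    set L : Finset ℕ := s.image fun i => lev i.1
    have h1 := h.sum_le_sum_biUnion L
    rw [sum_fiberCard, sum_fiberCard] at h1
    have h2 : lev' ⁻¹' (L.biUnion fun n => Finset.Icc (n - k) (n + k)) = s.biUnion t := by
      ext x
      simp only [Set.mem_preimage, SetLike.mem_coe, Finset.mem_biUnion, t,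
        Set.Finite.mem_toFinset, L, Finset.mem_image, hnb, exists_exists_and_eq_and]
    rw [h2, Set.encard_coe_eq_coe_finsetCard] at h1
    have h3 : ((s.map (Function.Embedding.subtype _) : Finset ι) : Set ι) ⊆ lev ⁻¹' L := by
      intro i hi
      simp only [Finset.coe_map, Set.mem_image] at hi
      obtain ⟨j, hj, rfl⟩ := hi
      exact Finset.mem_coe.2 (Finset.mem_image_of_mem (fun i : {i // P i} => lev i.1) hj)
    have h4 := (Set.encard_le_encard h3).trans h1
    rw [Set.encard_coe_eq_coe_finsetCard, Finset.card_map] at h4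
    exact_mod_cast h4
  obtain ⟨f, hf, hft⟩ := (Finset.all_card_le_biUnion_card_iff_exists_injective t).1 hall
  -- the other indices have an infinite fibre nearby
  have hinf : ∀ i, ¬ P i → ∃ m, (lev' ⁻¹' {m}).Infinite ∧ lev i ≤ m + k ∧ m ≤ lev i + k := by
    intro i hi
    by_contra! hcon
    refine hi ?_
    have : nb i = ⋃ m ∈ Finset.Icc (lev i - k) (lev i + k), lev' ⁻¹' {m} := by
      ext x
      simp [hnb]
    change (nb i).Finite
    rw [this]
    refine Set.Finite.biUnion (Finset.finite_toSet _) fun m hm => ?_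
    by_contra hm'
    have hm2 := Finset.mem_Icc.1 hm
    have := hcon m hm' (by omega)
    omega
  choose! lv hlv1 hlv2 using hinf
  have hemb : ∀ m, (lev' ⁻¹' {m}).Infinite →
      ∃ g : ι → ι', Function.Injective g ∧ ∀ i, lev' (g i) = m := by
    intro m hm
    obtain ⟨e, he⟩ := exists_injective_nat ι
    have : Infinite (lev' ⁻¹' {m}) := hm.to_subtype
    let g := Infinite.natEmbedding (lev' ⁻¹' {m})
    exact ⟨fun i => (g (e i)).1, fun i j hij => he (g.injective (Subtype.ext hij)),
      fun i => (g (e i)).2⟩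
  choose g hg1 hg2 using hemb
  refine ⟨fun i => if hi : P i then f ⟨i, hi⟩ else g (lv i) (hlv1 i hi) i, ?_, ?_⟩
  -- The two kinds of images cannot collide: candidate sets are unions of fibres, so one meeting an
  -- infinite fibre contains it and is infinite.
  · have key : ∀ i (hi : P i) j (hj : ¬ P j), f ⟨i, hi⟩ ≠ g (lv j) (hlv1 j hj) j := by
      intro i hi j hj hij
      have h1 : f ⟨i, hi⟩ ∈ nb i := by simpa [t] using hft ⟨i, hi⟩
      refine hlv1 j hj (hi.subset ?_)
      intro x hx
      have hx' : lev' x = lv j := hx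
      rw [hij] at h1
      simp only [hnb, Set.mem_preimage, hg2 _ (hlv1 j hj)] at h1
      simpa only [hnb, Set.mem_preimage, hx'] using h1
    intro i j hij
    by_cases hi : P i <;> by_cases hj : P j <;> simp only [hi, hj, dif_pos, dif_neg,
      not_false_eq_true] at hij
    · simpa using hf hij
    · exact (key i hi j hj hij).elim
    · exact (key j hj i hi hij.symm).elim
    · have h1 := hg2 _ (hlv1 i hi) i
      rw [hij, hg2 _ (hlv1 j hj)] at h1
      simp only [h1] at hij
      exact hg1 _ _ hij
  · intro i
    by_cases hi : P i <;> simp only [hi, dif_pos, dif_neg, not_false_eq_true]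
    · have h1 : f ⟨i, hi⟩ ∈ nb i := by simpa [t] using hft ⟨i, hi⟩
      simp only [hnb, Set.mem_preimage, SetLike.mem_coe, Finset.mem_Icc] at h1
      omega
    · rw [hg2 _ (hlv1 i hi)]
      exact hlv2 i hi

theorem ESigma.exists_bijective {ι ι' : Type*} [Countable ι] [Countable ι'] {lev : ι → ℕ}
    {lev' : ι' → ℕ} (h : ESigma (fiberCard lev) (fiberCard lev')) :
    ∃ (k : ℕ) (f : ι → ι'), Function.Bijective f ∧
      ∀ i, lev i ≤ lev' (f i) + k ∧ lev' (f i) ≤ lev i + k := by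
  obtain ⟨k, h1, h2⟩ := esigma_iff.1 h
  obtain ⟨f, hf, hfk⟩ := h1.exists_injective
  obtain ⟨g, hg, hgk⟩ := h2.exists_injective
  -- The bijection uses only values of `f` and of the inverse of `g`, so it inherits the bound on
  -- level shifts.
  obtain ⟨φ, hφ, hφk⟩ := Function.Embedding.schroeder_bernstein_of_rel hf hg
    (fun i j => lev i ≤ lev' j + k ∧ lev' j ≤ lev i + k) hfk fun j => (hgk j).symm
  exact ⟨k, φ, hφ, hφk⟩

theorem tsum_fiberCard_eq_top {ι : Type*} [Infinite ι] (lev : ι → ℕ) :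
    ∑' n, fiberCard lev n = ⊤ := by
  refine ENat.eq_top_iff_forall_ge.2 fun m => ?_
  obtain ⟨F, hF⟩ := Infinite.exists_subset_card_eq ι m
  classical
  calc (m : ℕ∞) = (F : Set ι).encard := by rw [Set.encard_coe_eq_coe_finsetCard, hF]
    _ ≤ (lev ⁻¹' (F.image lev)).encard := Set.encard_le_encard fun i hi =>
        Finset.mem_coe.2 (Finset.mem_image_of_mem lev hi)
    _ = ∑ n ∈ F.image lev, fiberCard lev n := (sum_fiberCard _ _).symm
    _ ≤ _ := by
      exact (hasSum_of_isLUB _ (isLUB_iSup)).summable.sum_le_tsum _ fun _ _ => zero_le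

end Matching

/-! ### Diagonal operators -/

section DiagonalOperators

variable {H : Type*} [NormedAddCommGroup H] [InnerProductSpace ℂ H] [CompleteSpace H]
variable {ι ι' : Type*}

namespace HilbertBasis

theorem hasSum_norm_inner_sq (e : HilbertBasis ι ℂ H) (x : H) :
    HasSum (fun i => ‖inner ℂ (e i) x‖ ^ 2) (‖x‖ ^ 2) := by
  have h := Complex.hasSum_re (e.hasSum_inner_mul_inner x x)
  rw [← inner_self_eq_norm_sq (𝕜 := ℂ)]
  refine h.congr_fun ?_
  intro i
  rw [← inner_conj_symm x (e i), ← Complex.normSq_eq_conj_mul_self, Complex.ofReal_re,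
    Complex.normSq_eq_norm_sq]

theorem ext_inner (e : HilbertBasis ι ℂ H) {x y : H}
    (h : ∀ i, inner ℂ (e i) x = inner ℂ (e i) y) : x = y := by
  refine e.repr.injective (lp.ext (funext fun i => ?_))
  simpa only [HilbertBasis.repr_apply_apply] using h i

theorem norm_le_mul_norm (e : HilbertBasis ι ℂ H) {x y : H} {C : ℝ} (hC : 0 ≤ C)
    (h : ∀ i, ‖inner ℂ (e i) y‖ ≤ C * ‖inner ℂ (e i) x‖) : ‖y‖ ≤ C * ‖x‖ := by
  refine le_of_sq_le_sq ?_ (by positivity)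
  rw [mul_pow]
  refine hasSum_le (fun i => ?_) (e.hasSum_norm_inner_sq y)
    ((e.hasSum_norm_inner_sq x).mul_left (C ^ 2))
  rw [← mul_pow]
  gcongr
  exact h i

theorem exists_diagonal (e : HilbertBasis ι ℂ H) (f : ι → ℝ) (hf : ∃ C, ∀ i, |f i| ≤ C) :
    ∃ M : H →L[ℂ] H, ∀ x i, inner ℂ (e i) (M x) = f i * inner ℂ (e i) x := by
  obtain ⟨C, hC⟩ := hf
  have hmem : ∀ x : H, Memℓp (fun i => (f i : ℂ) * inner ℂ (e i) x) 2 := by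
    intro x
    refine memℓp_gen ?_
    refine Summable.of_nonneg_of_le (fun i => by positivity) (fun i => ?_)
      ((e.hasSum_norm_inner_sq x).summable.mul_left (C ^ 2))
    rw [ENNReal.toReal_ofNat, Real.rpow_two, norm_mul, mul_pow]
    gcongr
    simpa using hC i
  let L : H → H := fun x => e.repr.symm ⟨fun i => (f i : ℂ) * inner ℂ (e i) x, hmem x⟩
  have hL : ∀ x i, inner ℂ (e i) (L x) = f i * inner ℂ (e i) x := by
    intro x i
    rw [← HilbertBasis.repr_apply_apply]
    simp [L]
  refine ⟨LinearMap.mkContinuous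
    { toFun := L
      map_add' := fun x y => e.ext_inner fun i => by
        simp only [hL, inner_add_right, mul_add]
      map_smul' := fun c x => e.ext_inner fun i => by
        simp only [hL, inner_smul_right, RingHom.id_apply]
        ring } |C| ?_, hL⟩
  intro x
  refine e.norm_le_mul_norm (abs_nonneg _) fun i => ?_
  rw [LinearMap.coe_mk, AddHom.coe_mk, hL, norm_mul]
  gcongr
  simpa using (hC i).trans (le_abs_self C)

open Classical in
/-- The diagonal operator with (bounded) real entries `f` in the Hilbert basis `e`. -/
noncomputable def diagonal (e : HilbertBasis ι ℂ H) (f : ι → ℝ) : H →L[ℂ] H :=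
  if hf : ∃ C, ∀ i, |f i| ≤ C then (e.exists_diagonal f hf).choose else 0

theorem inner_diagonal (e : HilbertBasis ι ℂ H) {f : ι → ℝ} {C : ℝ} (hf : ∀ i, |f i| ≤ C)
    (x : H) (i : ι) : inner ℂ (e i) (e.diagonal f x) = f i * inner ℂ (e i) x := by
  have hf' : ∃ C, ∀ i, |f i| ≤ C := ⟨C, hf⟩
  rw [diagonal, dif_pos hf']
  exact (e.exists_diagonal f hf').choose_spec x i

theorem inner_diagonal_left (e : HilbertBasis ι ℂ H) {f : ι → ℝ} {C : ℝ} (hf : ∀ i, |f i| ≤ C)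
    (x y : H) : inner ℂ (e.diagonal f x) y = inner ℂ x (e.diagonal f y) := by
  rw [← e.tsum_inner_mul_inner, ← e.tsum_inner_mul_inner]
  refine tsum_congr fun i => ?_
  rw [← inner_conj_symm, e.inner_diagonal hf, e.inner_diagonal hf, map_mul, inner_conj_symm,
    Complex.conj_ofReal]
  ring

/-- The diagonal operator with entries `2 ^ (-lev i)`. -/
noncomputable def levelOp (e : HilbertBasis ι ℂ H) (lev : ι → ℕ) : H →L[ℂ] H :=
  e.diagonal fun i => (1 / 2) ^ lev i

theorem abs_half_pow_le (n : ℕ) : |((1 : ℝ) / 2) ^ n| ≤ 1 := by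
  rw [abs_of_nonneg (by positivity)]
  exact pow_le_one₀ (by norm_num) (by norm_num)

theorem inner_levelOp (e : HilbertBasis ι ℂ H) (lev : ι → ℕ) (x : H) (i : ι) :
    inner ℂ (e i) (e.levelOp lev x) = (((1 / 2) ^ lev i : ℝ) : ℂ) * inner ℂ (e i) x :=
  e.inner_diagonal (fun i => abs_half_pow_le (lev i)) x i

theorem inner_levelOp_left (e : HilbertBasis ι ℂ H) (lev : ι → ℕ) (x y : H) :
    inner ℂ (e.levelOp lev x) y = inner ℂ x (e.levelOp lev y) :=
  e.inner_diagonal_left (fun i => abs_half_pow_le (lev i)) x y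

theorem levelOp_injective (e : HilbertBasis ι ℂ H) (lev : ι → ℕ) :
    Function.Injective (e.levelOp lev) := by
  intro x y hxy
  refine e.ext_inner fun i => ?_
  have h : inner ℂ (e i) (e.levelOp lev x) = inner ℂ (e i) (e.levelOp lev y) := by rw [hxy]
  rw [inner_levelOp, inner_levelOp] at h
  exact mul_left_cancel₀ (by simp) h

end HilbertBasis

/-- Operator ranges: an inclusion of ranges yields a bounded factorization. -/
theorem ContinuousLinearMap.exists_eq_comp_of_range_subset {T T' : H →L[ℂ] H}
    (hT' : Function.Injective T') (h : Set.range T ⊆ Set.range T') :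
    ∃ W : H →L[ℂ] H, ∀ x, T x = T' (W x) := by
  -- Preimages under the injective `T'` are unique, hence depend linearly on `x`; the closed graph
  -- theorem makes them continuous.
  choose w hw using fun x => h (Set.mem_range_self x)
  let L : H →ₗ[ℂ] H :=
    { toFun := w
      map_add' := fun x y => hT' (by simp [hw])
      map_smul' := fun c x => hT' (by simp [hw]) }
  have hcont : Continuous L := by
    refine L.continuous_of_seq_closed_graph fun u x y hu hy => hT' ?_
    have h1 := (T'.continuous.tendsto y).comp hy
    have h2 := (T.continuous.tendsto x).comp hu
    refine tendsto_nhds_unique h1 ((h2.congr fun n => ?_).trans_eq ?_)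
    · exact (hw (u n)).symm
    · rw [← hw x]; rfl
  exact ⟨⟨L, hcont⟩, fun x => (hw x).symm⟩

/-- The set `G` imposes fewer linear conditions than there are coefficients, and independence keeps
a nonzero solution from collapsing to 0. -/
theorem Submodule.exists_mem_span_ne_zero_inner_eq_zero {v : ι → H} {v' : ι' → H}
    (hv : LinearIndependent ℂ v) (F : Finset ι) (G : Finset ι') (hFG : G.card < F.card) :
    ∃ x ∈ Submodule.span ℂ (v '' F), x ≠ 0 ∧ ∀ j ∈ G, inner ℂ (v' j) x = 0 := by
  classical
  let Φ : (F → ℂ) →ₗ[ℂ] (G → ℂ) :=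
    LinearMap.pi fun j => ∑ i : F, inner ℂ (v' j) (v i) • LinearMap.proj i
  have hker : LinearMap.ker Φ ≠ ⊥ := LinearMap.ker_ne_bot_of_finrank_lt (by simpa using hFG)
  obtain ⟨c, hc, hc0⟩ := Submodule.exists_mem_ne_zero_of_ne_bot hker
  refine ⟨∑ i : F, c i • v i, ?_, ?_, ?_⟩
  · exact Submodule.sum_mem _ fun i _ => Submodule.smul_mem _ _
      (Submodule.subset_span ⟨i, i.2, rfl⟩)
  · intro h0
    have hvF : LinearIndependent ℂ fun i : F => v i := hv.comp _ Subtype.val_injective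
    exact hc0 (funext fun i => Fintype.linearIndependent_iff.1 hvF c h0 i)
  · intro j hj
    have := congrFun (LinearMap.mem_ker.1 hc) ⟨j, hj⟩
    simp only [Φ, LinearMap.pi_apply, LinearMap.sum_apply, LinearMap.smul_apply,
      LinearMap.proj_apply, smul_eq_mul, Pi.zero_apply] at this
    rw [inner_sum, ← this]
    refine Finset.sum_congr rfl fun i _ => ?_
    rw [inner_smul_right, mul_comm]

theorem HilbertBasis.inner_eq_zero_of_mem_span (e : HilbertBasis ι ℂ H) {s : Set ι} {x : H}
    (hx : x ∈ Submodule.span ℂ (e '' s)) {i : ι} (hi : i ∉ s) : inner ℂ (e i) x = 0 := by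
  induction hx using Submodule.span_induction with
  | mem x hx =>
    obtain ⟨j, hj, rfl⟩ := hx
    exact e.orthonormal.2 fun h => hi (h ▸ hj)
  | zero => exact inner_zero_right _
  | add x y _ _ hx hy => rw [inner_add_right, hx, hy, add_zero]
  | smul c x _ hx => rw [inner_smul_right, hx, mul_zero]

/-- A vector spanned by levels in [n, m] of `e` must nearly live on levels in [n - k, m + k] of
`e'`, since each factorization bounds the leakage on one side by a multiple of 2⁻ᵏ. Too many
dimensions in the first window would produce a vector that leaks entirely. -/
theorem HilbertBasis.windowLE_of_factorization (e : HilbertBasis ι ℂ H) (e' : HilbertBasis ι' ℂ H)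
    {lev : ι → ℕ} {lev' : ι' → ℕ} {W W' : H →L[ℂ] H}
    (hW : ∀ x, e.levelOp lev x = e'.levelOp lev' (W x))
    (hW' : ∀ x, e'.levelOp lev' x = e.levelOp lev (W' x)) {k : ℕ}
    (hk : (‖W‖ + ‖W'‖) * (1 / 2) ^ k < 1) :
    WindowLE k (fiberCard lev) (fiberCard lev') := by
  classical
  intro n m
  by_contra! hlt
  rw [sum_fiberCard, sum_fiberCard] at hlt
  have hfin : (lev' ⁻¹' (Finset.Icc (n - k) (m + k))).Finite :=
    Set.encard_lt_top_iff.1 (hlt.trans_le le_top)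
  obtain ⟨G, hG⟩ := hfin.exists_finset_coe
  rw [← hG, Set.encard_coe_eq_coe_finsetCard] at hlt
  -- The first window may contain infinitely many indices; one more than in `G` is enough.
  obtain ⟨F', hF', hF'c⟩ := Set.exists_subset_encard_eq (Order.add_one_le_of_lt hlt)
  have hF'fin : F'.Finite := Set.encard_lt_top_iff.1 (by
    rw [hF'c]; exact_mod_cast ENat.natCast_lt_top (G.card + 1))
  obtain ⟨F, rfl⟩ := hF'fin.exists_finset_coe
  rw [Set.encard_coe_eq_coe_finsetCard] at hF'c
  have hcard : G.card < F.card := by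
    have : F.card = G.card + 1 := by exact_mod_cast hF'c
    omega
  obtain ⟨x, hxF, hx0, hxG⟩ := Submodule.exists_mem_span_ne_zero_inner_eq_zero (v' := e')
    e.orthonormal.linearIndependent F G hcard
  have hxout : ∀ i, ¬ (n ≤ lev i ∧ lev i ≤ m) → inner ℂ (e i) x = 0 := by
    intro i hi
    refine e.inner_eq_zero_of_mem_span hxF fun hiF => hi ?_
    have := hF' hiF
    rwa [Set.mem_preimage, Finset.mem_coe, Finset.mem_Icc] at this
  have hxin : ∀ j, n - k ≤ lev' j → lev' j ≤ m + k → inner ℂ (e' j) x = 0 := by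
    intro j h1 h2
    refine hxG j ?_
    rw [← Finset.mem_coe, hG]
    exact Finset.mem_coe.2 (Finset.mem_Icc.2 ⟨h1, h2⟩)
  have hpow : ∀ p : ℕ, (2 : ℝ) ^ p * (1 / 2) ^ p = 1 := fun p => by
    rw [← mul_pow]; norm_num
  -- the low and the high part of `x`
  have hlow : ∀ j, |if lev' j + k < n then (1 : ℝ) else 0| ≤ 1 := fun j => by split_ifs <;> simp
  have hhigh : ∀ j, |if m + k < lev' j then (1 : ℝ) else 0| ≤ 1 := fun j => by
    split_ifs <;> simp
  set y := e'.diagonal (fun j => if lev' j + k < n then (1 : ℝ) else 0) x with hy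
  set z := e'.diagonal (fun j => if m + k < lev' j then (1 : ℝ) else 0) x with hz
  have hyc := e'.inner_diagonal hlow x
  have hzc := e'.inner_diagonal hhigh x
  rw [← hy] at hyc
  rw [← hz] at hzc
  have hxyz : x = y + z := by
    refine e'.ext_inner fun j => ?_
    rw [inner_add_right, hyc, hzc]
    by_cases h1 : lev' j + k < n
    · by_cases h2 : m + k < lev' j
      -- Being both low and high forces m < n, an empty window.
      · have hx : x = 0 := e.ext_inner fun i => by
          rw [hxout i (by omega), inner_zero_right]
        exact absurd hx hx0
      · simp [h1, h2]
    · by_cases h2 : m + k < lev' j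
      · simp [h1, h2]
      · simp [h1, h2, hxin j (by omega) (by omega)]
  -- the high part is small
  have hzle : ‖z‖ ≤ ‖W‖ * (1 / 2) ^ k * ‖x‖ := by
    have hwb : ∀ i, |if lev i ≤ m then (2 : ℝ) ^ lev i else 0| ≤ 2 ^ m := fun i => by
      split_ifs with h
      · rw [abs_of_nonneg (by positivity)]
        exact pow_le_pow_right₀ (by norm_num) h
      · simp
    -- With T and T' the two level operators, `w` is T⁻¹ x, the cut-off at `m` keeping the entries
    -- bounded. Inverting costs at most 2ᵐ, while the high components of x = T' W w carry the factor
    -- 2⁻⁽ᵐ⁺ᵏ⁾.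
    set w := e.diagonal (fun i => if lev i ≤ m then (2 : ℝ) ^ lev i else 0) x with hw
    have hwn : ‖w‖ ≤ 2 ^ m * ‖x‖ := e.norm_le_mul_norm (by positivity) fun i => by
      rw [hw, e.inner_diagonal hwb, norm_mul, Complex.norm_real]
      gcongr
      exact hwb i
    have hxw : x = e'.levelOp lev' (W w) := by
      rw [← hW]
      refine e.ext_inner fun i => ?_
      rw [e.inner_levelOp, hw, e.inner_diagonal hwb]
      by_cases h : lev i ≤ m
      · rw [if_pos h, ← mul_assoc, ← Complex.ofReal_mul, mul_comm ((1 / 2 : ℝ) ^ _), hpow,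
          Complex.ofReal_one, one_mul]
      · simp [h, hxout i (by omega)]
    have hz1 : ‖z‖ ≤ (1 / 2) ^ (m + k) * ‖W w‖ :=
      e'.norm_le_mul_norm (by positivity) fun j => by
        rw [hzc]
        by_cases h : m + k < lev' j
        · rw [if_pos h, Complex.ofReal_one, one_mul]
          conv_lhs => rw [hxw]
          rw [e'.inner_levelOp, norm_mul, Complex.norm_real, Real.norm_of_nonneg (by positivity)]
          refine mul_le_mul_of_nonneg_right ?_ (norm_nonneg _)
          exact pow_le_pow_of_le_one (by norm_num) (by norm_num) h.le
        · rw [if_neg h, Complex.ofReal_zero, zero_mul, norm_zero]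
          positivity
    calc ‖z‖ ≤ (1 / 2) ^ (m + k) * ‖W w‖ := hz1
      _ ≤ (1 / 2) ^ (m + k) * (‖W‖ * (2 ^ m * ‖x‖)) := by
        gcongr
        exact (W.le_opNorm w).trans (by gcongr)
      _ = (2 ^ m * (1 / 2) ^ m) * (‖W‖ * (1 / 2) ^ k * ‖x‖) := by ring
      _ = _ := by rw [hpow, one_mul]
  -- the low part is small
  have hyle : ‖y‖ ≤ ‖W'‖ * (1 / 2) ^ k * ‖x‖ := by
    have hvb : ∀ j, |if lev' j + k < n then (2 : ℝ) ^ lev' j else 0| ≤ 2 ^ n * (1 / 2) ^ k := by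
      intro j
      split_ifs with h
      · rw [abs_of_nonneg (by positivity)]
        calc (2 : ℝ) ^ lev' j = 2 ^ lev' j * (2 ^ k * (1 / 2) ^ k) := by rw [hpow, mul_one]
          _ = 2 ^ (lev' j + k) * (1 / 2) ^ k := by ring
          _ ≤ _ := by
            gcongr
            · norm_num
      · rw [abs_zero]; positivity
    -- Dually, `v` is T'⁻¹ y, of norm at most 2ⁿ⁻ᵏ ‖y‖, and ‖y‖² = ⟨x, y⟩ = ⟨x, T W' v⟩ = ⟨T x, W'
    -- v⟩ with ‖T x‖ ≤ 2⁻ⁿ ‖x‖.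
    set v := e'.diagonal (fun j => if lev' j + k < n then (2 : ℝ) ^ lev' j else 0) x with hv
    have hvn : ‖v‖ ≤ 2 ^ n * (1 / 2) ^ k * ‖y‖ := e'.norm_le_mul_norm (by positivity) fun j => by
      rw [hyc, hv, e'.inner_diagonal hvb]
      have := hvb j
      split_ifs at this ⊢ with h
      · rw [Complex.ofReal_one, one_mul, norm_mul, Complex.norm_real, Real.norm_eq_abs]
        gcongr
      · simp
    have hyv : y = e.levelOp lev (W' v) := by
      rw [← hW']
      refine e'.ext_inner fun j => ?_
      rw [hyc, e'.inner_levelOp, hv, e'.inner_diagonal hvb]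
      split_ifs with h
      · rw [← mul_assoc, ← Complex.ofReal_mul, mul_comm ((1 / 2 : ℝ) ^ _), hpow]
      · simp
    have hTx : ‖e.levelOp lev x‖ ≤ (1 / 2) ^ n * ‖x‖ :=
      e.norm_le_mul_norm (by positivity) fun i => by
        rw [e.inner_levelOp, norm_mul, Complex.norm_real, Real.norm_of_nonneg (by positivity)]
        by_cases h : n ≤ lev i
        · refine mul_le_mul_of_nonneg_right ?_ (norm_nonneg _)
          exact pow_le_pow_of_le_one (by norm_num) (by norm_num) h
        · simp [hxout i (by omega)]
    have hyy : inner ℂ x y = inner ℂ y y := by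
      have h1 : y = e'.diagonal (fun j => if lev' j + k < n then (1 : ℝ) else 0) y := by
        refine e'.ext_inner fun j => ?_
        rw [e'.inner_diagonal hlow y, hyc]
        split_ifs <;> simp
      conv_rhs => rw [hy, e'.inner_diagonal_left hlow, ← hy, ← h1]
    have hy2 : ‖y‖ ^ 2 ≤ (‖W'‖ * (1 / 2) ^ k * ‖x‖) * ‖y‖ := by
      calc ‖y‖ ^ 2 = ‖inner ℂ x y‖ := by
            rw [hyy, inner_self_eq_norm_sq_to_K]
            simp
        _ = ‖inner ℂ (e.levelOp lev x) (W' v)‖ := by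
            rw [e.inner_levelOp_left, ← hyv]
        _ ≤ ‖e.levelOp lev x‖ * ‖W' v‖ := norm_inner_le_norm _ _
        _ ≤ ((1 / 2) ^ n * ‖x‖) * (‖W'‖ * (2 ^ n * (1 / 2) ^ k * ‖y‖)) := by
            gcongr
            exact (W'.le_opNorm v).trans (by gcongr)
        _ = (2 ^ n * (1 / 2) ^ n) * ((‖W'‖ * (1 / 2) ^ k * ‖x‖) * ‖y‖) := by ring
        _ = _ := by rw [hpow, one_mul]
    rcases (norm_nonneg y).eq_or_lt' with h0 | h0
    · rw [h0]; positivity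
    · rw [pow_two] at hy2
      exact le_of_mul_le_mul_right hy2 h0
  have hxpos : 0 < ‖x‖ := norm_pos_iff.2 hx0
  have h1 : ‖x‖ ≤ ‖y‖ + ‖z‖ := by
    conv_lhs => rw [hxyz]
    exact norm_add_le _ _
  nlinarith

theorem HilbertBasis.esigma_of_range_eq (e : HilbertBasis ι ℂ H) (e' : HilbertBasis ι' ℂ H)
    {lev : ι → ℕ} {lev' : ι' → ℕ}
    (h : Set.range (e.levelOp lev) = Set.range (e'.levelOp lev')) :
    ESigma (fiberCard lev) (fiberCard lev') := by
  obtain ⟨W, hW⟩ := ContinuousLinearMap.exists_eq_comp_of_range_subset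
    (e'.levelOp_injective lev') h.subset
  obtain ⟨W', hW'⟩ := ContinuousLinearMap.exists_eq_comp_of_range_subset
    (e.levelOp_injective lev) h.symm.subset
  have hlim := (tendsto_pow_atTop_nhds_zero_of_lt_one (r := (1 / 2 : ℝ)) (by norm_num)
    (by norm_num)).const_mul (‖W‖ + ‖W'‖)
  rw [mul_zero] at hlim
  obtain ⟨k, hk⟩ := (hlim.eventually_lt_const one_pos).exists
  exact esigma_iff.2 ⟨k, e.windowLE_of_factorization e' hW hW' hk,
    e'.windowLE_of_factorization e hW' hW (by rwa [add_comm])⟩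

/-- The image of a Hilbert basis under a unitary. -/
noncomputable def HilbertBasis.mapUnitary (e : HilbertBasis ι ℂ H) (u : H ≃ₗᵢ[ℂ] H) :
    HilbertBasis ι ℂ H :=
  HilbertBasis.ofRepr (u.symm.trans e.repr)

theorem HilbertBasis.inner_mapUnitary (e : HilbertBasis ι ℂ H) (u : H ≃ₗᵢ[ℂ] H) (i : ι) (x : H) :
    inner ℂ (e.mapUnitary u i) x = inner ℂ (e i) (u.symm x) := by
  rw [← HilbertBasis.repr_apply_apply, ← HilbertBasis.repr_apply_apply]
  rfl

theorem HilbertBasis.image_range_levelOp (e : HilbertBasis ι ℂ H) (u : H ≃ₗᵢ[ℂ] H)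
    (lev : ι → ℕ) :
    u '' Set.range (e.levelOp lev) = Set.range ((e.mapUnitary u).levelOp lev) := by
  have key : ∀ x, (e.mapUnitary u).levelOp lev (u x) = u (e.levelOp lev x) := fun x =>
    (e.mapUnitary u).ext_inner fun i => by
      rw [inner_levelOp, inner_mapUnitary, inner_mapUnitary, u.symm_apply_apply,
        u.symm_apply_apply, inner_levelOp]
  rw [← Set.range_comp, ← u.surjective.range_comp ((e.mapUnitary u).levelOp lev)]
  exact congrArg Set.range (funext fun x => (key x).symm)

/-- Quotients of corresponding diagonal entries lie between 2⁻ᵏ and 2ᵏ, so each operator is the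
other times a bounded diagonal one. -/
theorem HilbertBasis.range_levelOp_eq_of_reindex (e : HilbertBasis ι ℂ H)
    (e' : HilbertBasis ι' ℂ H) {lev : ι → ℕ} {lev' : ι' → ℕ} {k : ℕ} {φ : ι → ι'}
    (hφ : Function.Surjective φ) (he : ∀ i, e i = e' (φ i))
    (hk : ∀ i, lev i ≤ lev' (φ i) + k ∧ lev' (φ i) ≤ lev i + k) :
    Set.range (e.levelOp lev) = Set.range (e'.levelOp lev') := by
  have hpow : ∀ p : ℕ, (2 : ℝ) ^ p * (1 / 2) ^ p = 1 := fun p => by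
    rw [← mul_pow]; norm_num
  have hb : ∀ p q : ℕ, p ≤ q + k → |(2 : ℝ) ^ p * (1 / 2) ^ q| ≤ 2 ^ k := by
    intro p q hpq
    rw [abs_of_nonneg (by positivity)]
    calc (2 : ℝ) ^ p * (1 / 2) ^ q ≤ 2 ^ (q + k) * (1 / 2) ^ q := by
          gcongr
          norm_num
      _ = 2 ^ k * (2 ^ q * (1 / 2) ^ q) := by ring
      _ = _ := by rw [hpow, mul_one]
  refine Set.Subset.antisymm ?_ ?_
  · rintro _ ⟨x, rfl⟩
    refine ⟨e.diagonal (fun i => 2 ^ lev' (φ i) * (1 / 2) ^ lev i) x, e'.ext_inner fun j => ?_⟩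
    obtain ⟨i, rfl⟩ := hφ j
    rw [e'.inner_levelOp, ← he, e.inner_levelOp, e.inner_diagonal fun i => hb _ _ (hk i).2,
      ← mul_assoc, ← Complex.ofReal_mul, ← mul_assoc, mul_comm ((1 / 2 : ℝ) ^ _), hpow, one_mul]
  · rintro _ ⟨x, rfl⟩
    refine ⟨e.diagonal (fun i => 2 ^ lev i * (1 / 2) ^ lev' (φ i)) x, e.ext_inner fun i => ?_⟩
    rw [e.inner_levelOp, e.inner_diagonal fun i => hb _ _ (hk i).1, he, e'.inner_levelOp,
      ← mul_assoc, ← Complex.ofReal_mul, ← mul_assoc, mul_comm ((1 / 2 : ℝ) ^ _), hpow, one_mul]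

/-- Unitary equivalence of diagonal operator ranges is comparison of the multiplicities. -/
theorem HilbertBasis.exists_unitary_image_eq_iff [Countable ι] [Countable ι']
    (e : HilbertBasis ι ℂ H) (e' : HilbertBasis ι' ℂ H) (lev : ι → ℕ) (lev' : ι' → ℕ) :
    (∃ u : unitary (H →L[ℂ] H),
      (u : H →L[ℂ] H) '' Set.range (e.levelOp lev) = Set.range (e'.levelOp lev')) ↔
    ESigma (fiberCard lev) (fiberCard lev') := by
  constructor
  · rintro ⟨u, hu⟩
    have h := e.image_range_levelOp (Unitary.linearIsometryEquiv u) lev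
    exact (e.mapUnitary (Unitary.linearIsometryEquiv u)).esigma_of_range_eq e'
      (h.symm.trans hu)
  · intro h
    obtain ⟨k, φ, hφ, hk⟩ := h.exists_bijective
    have horth : Orthonormal ℂ (e' ∘ φ) := e'.orthonormal.comp φ hφ.1
    let e'' : HilbertBasis ι ℂ H := HilbertBasis.mk horth (by
      rw [hφ.2.range_comp]
      exact e'.dense_span.ge)
    have he'' : ∀ i, e'' i = e' (φ i) := fun i => by simp [e'']
    -- The unitary carrying `e i` to `e' (φ i)`.
    let u : H ≃ₗᵢ[ℂ] H := e.repr.trans e''.repr.symm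
    have hu : e.mapUnitary u = e'' := by
      have h : (e.mapUnitary u).repr = e''.repr := by
        ext1 x
        simp [HilbertBasis.mapUnitary, u]
      rcases hh : e.mapUnitary u with ⟨r⟩
      rw [hh] at h
      change r = e''.repr at h
      rw [h]
    refine ⟨Unitary.linearIsometryEquiv.symm u, ?_⟩
    rw [← e''.range_levelOp_eq_of_reindex e' hφ.2 he'' hk, ← hu, ← e.image_range_levelOp]
    rfl

end DiagonalOperators

/-! ### Spectral subspaces of bounded self-adjoint operators -/

section SpectralSubspaces

universe u

variable {H : Type u} [NormedAddCommGroup H] [InnerProductSpace ℂ H] [CompleteSpace H]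

namespace ContinuousLinearMap

theorem mul_apply_eq (A B : H →L[ℂ] H) (x : H) : (A * B) x = A (B x) := rfl

/-- The positive part `(S - t)⁺` of `S - t`. -/
noncomputable def excess (S : H →L[ℂ] H) (t : ℝ) : H →L[ℂ] H :=
  cfc (fun x : ℝ => max (x - t) 0) S

/-- The spectral subspace of `S` for the half-line `(-∞, t]`. -/
noncomputable def lowSpace (S : H →L[ℂ] H) (t : ℝ) : Submodule ℂ H := (S.excess t).ker

instance (S : H →L[ℂ] H) (t : ℝ) : CompleteSpace (S.lowSpace t) :=
  inferInstanceAs (CompleteSpace (S.excess t).ker)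

theorem mem_lowSpace {S : H →L[ℂ] H} {t : ℝ} {x : H} : x ∈ S.lowSpace t ↔ S.excess t x = 0 :=
  Iff.rfl

theorem inner_cfc_left (S : H →L[ℂ] H) (f : ℝ → ℝ) (x y : H) :
    inner ℂ (cfc f S x) y = inner ℂ x (cfc f S y) :=
  isSelfAdjoint_iff_isSymmetric.1 (cfc_predicate f S) x y

theorem re_inner_cfc_nonneg (S : H →L[ℂ] H) {f : ℝ → ℝ} (hf : Continuous f)
    (h0 : ∀ x, 0 ≤ f x) (x : H) : 0 ≤ (inner ℂ (cfc f S x) x).re := by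
  have h : cfc f S = cfc (fun x => √(f x)) S * cfc (fun x => √(f x)) S := by
    rw [← cfc_mul _ _ _ (by fun_prop) (by fun_prop)]
    exact congrArg (cfc · S) (funext fun x => (Real.mul_self_sqrt (h0 x)).symm)
  rw [h, mul_apply_eq, inner_cfc_left]
  exact inner_self_nonneg (𝕜 := ℂ)

/-- The decomposition S - t = (S - t)⁺ - (S - t)⁻. Continuous functional calculus is all that the
spectral subspaces below require. -/
theorem apply_eq_excess_sub (S : H →L[ℂ] H) (hS : IsSelfAdjoint S) (t : ℝ) (x : H) :
    S x = S.excess t x - cfc (fun x : ℝ => max (t - x) 0) S x + t • x := by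
  have h : S = S.excess t - cfc (fun x : ℝ => max (t - x) 0) S + algebraMap ℝ (H →L[ℂ] H) t := by
    rw [excess, ← cfc_const t S hS, ← cfc_sub _ _ _ (by fun_prop) (by fun_prop),
      ← cfc_add _ _ _ (by fun_prop) (by fun_prop)]
    conv_lhs => rw [← cfc_id ℝ S]
    refine congrArg (cfc · S) (funext fun x => ?_)
    rcases le_total x t with h | h <;> simp [h]
  conv_lhs => rw [h]
  simp [Algebra.algebraMap_eq_smul_one]

theorem re_inner_le_of_mem_lowSpace {S : H →L[ℂ] H} (hS : IsSelfAdjoint S) {t : ℝ} {x : H}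
    (hx : x ∈ S.lowSpace t) : (inner ℂ (S x) x).re ≤ t * ‖x‖ ^ 2 := by
  have h := re_inner_cfc_nonneg S (f := fun x : ℝ => max (t - x) 0) (by fun_prop)
    (fun x => le_max_right _ _) x
  rw [apply_eq_excess_sub S hS t x, mem_lowSpace.1 hx, zero_sub, inner_add_left, inner_neg_left,
    Complex.add_re, Complex.neg_re, ← Complex.coe_smul, inner_smul_left, Complex.conj_ofReal,
    Complex.re_ofReal_mul, ← inner_self_eq_norm_sq (𝕜 := ℂ)]
  have h2 : (inner ℂ x x).re = RCLike.re (inner ℂ x x) := rfl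
  rw [h2]
  linarith

/-- Since (S - t)⁺ (S - t)⁻ = 0, the range of the negative part lies in the kernel of the positive
part, so on the orthogonal complement only the positive part contributes. -/
theorem le_re_inner_of_mem_lowSpace_orthogonal {S : H →L[ℂ] H} (hS : IsSelfAdjoint S) {t : ℝ}
    {x : H} (hx : x ∈ (S.lowSpace t)ᗮ) : t * ‖x‖ ^ 2 ≤ (inner ℂ (S x) x).re := by
  have h := re_inner_cfc_nonneg S (f := fun x : ℝ => max (x - t) 0) (by fun_prop)
    (fun x => le_max_right _ _) x
  have h0 : cfc (fun x : ℝ => max (t - x) 0) S x ∈ S.lowSpace t := by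
    rw [mem_lowSpace, excess, ← mul_apply_eq, ← cfc_mul _ _ _ (by fun_prop) (by fun_prop)]
    have : (fun x : ℝ => max (x - t) 0 * max (t - x) 0) = fun _ => 0 := by
      funext x
      rcases le_total x t with h | h <;> simp [h]
    rw [this, cfc_const_zero, zero_apply]
  rw [apply_eq_excess_sub S hS t x, inner_add_left, inner_sub_left,
    (Submodule.mem_orthogonal _ _).1 hx _ h0, sub_zero,
    Complex.add_re, ← Complex.coe_smul, inner_smul_left, Complex.conj_ofReal,
    Complex.re_ofReal_mul, ← inner_self_eq_norm_sq (𝕜 := ℂ)]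
  have h2 : (inner ℂ x x).re = RCLike.re (inner ℂ x x) := rfl
  rw [h2]
  exact le_add_of_nonneg_left h

theorem lowSpace_mono (S : H →L[ℂ] H) {s t : ℝ} (hst : s ≤ t) : S.lowSpace s ≤ S.lowSpace t := by
  rcases hst.eq_or_lt with rfl | hlt
  · exact le_rfl
  intro x hx
  have hpos : ∀ y : ℝ, 0 < max (y - s) (t - s) := fun y => lt_max_of_lt_right (sub_pos.2 hlt)
  -- The denominator agrees with y - s wherever the numerator is nonzero, and its lower bound t - s
  -- makes the quotient continuous.
  have h : S.excess t =
      cfc (fun y : ℝ => max (y - t) 0 / max (y - s) (t - s)) S * S.excess s := by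
    rw [excess, excess, ← cfc_mul (fun y : ℝ => max (y - t) 0 / max (y - s) (t - s)) _ _
      (Continuous.continuousOn (Continuous.div (by fun_prop) (by fun_prop) fun y => (hpos y).ne'))
      (by fun_prop)]
    refine congrArg (cfc · S) (funext fun y => ?_)
    rcases le_total y t with h | h
    · simp [h]
    · have h1 : 0 ≤ y - s := by linarith
      have h2 : t - s ≤ y - s := by linarith
      rw [max_eq_left h1, max_eq_left h2, div_mul_cancel₀]
      linarith
  rw [mem_lowSpace] at hx ⊢
  rw [h, mul_apply_eq, hx, map_zero]

theorem lowSpace_eq_top {S : H →L[ℂ] H} (hS : IsSelfAdjoint S) {t : ℝ} (ht : ‖S‖ < t) :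
    S.lowSpace t = ⊤ := by
  rw [← Submodule.orthogonal_eq_bot_iff, Submodule.eq_bot_iff]
  intro x hx
  have h1 := le_re_inner_of_mem_lowSpace_orthogonal hS hx
  have h2 : (inner ℂ (S x) x).re ≤ ‖S‖ * ‖x‖ ^ 2 := by
    calc (inner ℂ (S x) x).re ≤ ‖inner ℂ (S x) x‖ := Complex.re_le_norm _
      _ ≤ ‖S x‖ * ‖x‖ := norm_inner_le_norm _ _
      _ ≤ (‖S‖ * ‖x‖) * ‖x‖ := by gcongr; exact S.le_opNorm x
      _ = _ := by ring
  by_contra hx0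
  have : 0 < ‖x‖ ^ 2 := by positivity
  nlinarith

theorem apply_mem_lowSpace {S : H →L[ℂ] H} (hS : IsSelfAdjoint S) {t : ℝ} {x : H}
    (hx : x ∈ S.lowSpace t) : S x ∈ S.lowSpace t := by
  have hcomm : S.excess t * S = S * S.excess t := by
    have h := cfc_commute_cfc (fun x : ℝ => max (x - t) 0) id S
    rw [cfc_id ℝ S] at h
    exact h
  rw [mem_lowSpace, ← mul_apply_eq, hcomm, mul_apply_eq, mem_lowSpace.1 hx, map_zero]

theorem apply_mem_lowSpace_orthogonal {S : H →L[ℂ] H} (hS : IsSelfAdjoint S) {t : ℝ} {x : H}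
    (hx : x ∈ (S.lowSpace t)ᗮ) : S x ∈ (S.lowSpace t)ᗮ := by
  rw [Submodule.mem_orthogonal] at hx ⊢
  intro y hy
  have := isSelfAdjoint_iff_isSymmetric.1 hS y x
  simp only [coe_coe] at this
  rw [← this]
  exact hx _ (apply_mem_lowSpace hS hy)

/-- The norm on the left is the distance from `x` to the closed range of (S - t)⁺, the complement of
its kernel. The right side is a union of conditions open in `S` for the strong topology once (S -
t)⁺ depends continuously on `S`. -/
theorem norm_starProjection_lowSpace_lt_iff (S : H →L[ℂ] H) (t : ℝ) (x : H) (r : ℝ) :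
    ‖(S.lowSpace t).starProjection x‖ < r ↔ ∃ y, ‖x - S.excess t y‖ < r := by
  have horth : (S.lowSpace t)ᗮ = (S.excess t).range.topologicalClosure := by
    rw [lowSpace, ContinuousLinearMap.orthogonal_ker]
    congr 3
    exact cfc_predicate (fun x : ℝ => max (x - t) 0) S
  constructor
  · intro h
    have hmem := Submodule.sub_starProjection_mem_orthogonal (K := S.lowSpace t) x
    rw [horth, ← SetLike.mem_coe, Submodule.topologicalClosure_coe,
      Metric.mem_closure_iff] at hmem
    obtain ⟨_, ⟨y, rfl⟩, hy⟩ := hmem (r - ‖(S.lowSpace t).starProjection x‖) (sub_pos.2 h)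
    refine ⟨y, ?_⟩
    rw [dist_eq_norm] at hy
    calc ‖x - S.excess t y‖ = ‖(x - (S.lowSpace t).starProjection x - S.excess t y) +
          (S.lowSpace t).starProjection x‖ := by congr 1; abel
      _ ≤ _ := norm_add_le _ _
      _ < r := by
        have hy' : ‖x - (S.lowSpace t).starProjection x - S.excess t y‖ <
          r - ‖(S.lowSpace t).starProjection x‖ := hy
        linarith
  · rintro ⟨y, hy⟩
    refine lt_of_le_of_lt ?_ hy
    have h0 : (S.lowSpace t).starProjection (S.excess t y) = 0 := by
      rw [Submodule.starProjection_apply_eq_zero_iff, horth]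
      exact Submodule.le_topologicalClosure _ (LinearMap.mem_range_self _ y)
    calc ‖(S.lowSpace t).starProjection x‖ =
          ‖(S.lowSpace t).starProjection (x - S.excess t y)‖ := by rw [map_sub, h0, sub_zero]
      _ ≤ _ := Submodule.norm_starProjection_apply_le _ _

end ContinuousLinearMap

/-- The part of `K` orthogonal to `L`. -/
noncomputable abbrev Submodule.orthogonalDiff (K L : Submodule ℂ H) : Submodule ℂ H := K ⊓ Lᗮ

instance (K L : Submodule ℂ H) [hK : CompleteSpace K] : CompleteSpace (K.orthogonalDiff L) := by
  have h1 : IsClosed (K : Set H) := (completeSpace_coe_iff_isComplete.1 hK).isClosed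
  exact (h1.inter (Submodule.isClosed_orthogonal L)).completeSpace_coe

theorem Submodule.norm_sq_starProjection_orthogonalDiff {K L : Submodule ℂ H} [CompleteSpace K]
    [CompleteSpace L] (hLK : L ≤ K) (x : H) :
    ‖(K.orthogonalDiff L).starProjection x‖ ^ 2 =
      ‖K.starProjection x‖ ^ 2 - ‖L.starProjection x‖ ^ 2 := by
  have hK := K.sub_starProjection_mem_orthogonal x
  have hL := L.sub_starProjection_mem_orthogonal x
  have hd : K.starProjection x - L.starProjection x ∈ Lᗮ := by
    have := Lᗮ.sub_mem hL (Submodule.orthogonal_le hLK hK)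
    simpa using this
  have h : (K.orthogonalDiff L).starProjection x = K.starProjection x - L.starProjection x := by
    refine Submodule.eq_starProjection_of_mem_orthogonal ⟨?_, hd⟩ ?_
    · exact K.sub_mem (K.starProjection_apply_mem x) (hLK (L.starProjection_apply_mem x))
    · have h1 := Submodule.orthogonal_le (inf_le_left : K.orthogonalDiff L ≤ K) hK
      have h2 : L.starProjection x ∈ (K.orthogonalDiff L)ᗮ :=
        (L.le_orthogonal_orthogonal.trans (Submodule.orthogonal_le inf_le_right))
          (L.starProjection_apply_mem x)
      have := (K.orthogonalDiff L)ᗮ.add_mem h1 h2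
      rwa [← sub_add]
  have hsplit : K.starProjection x =
      L.starProjection x + (K.starProjection x - L.starProjection x) := by abel
  have hpyth := norm_add_sq_eq_norm_sq_add_norm_sq_of_inner_eq_zero (𝕜 := ℂ) _ _
    ((Submodule.mem_orthogonal _ _).1 hd _ (L.starProjection_apply_mem x))
  rw [← hsplit] at hpyth
  rw [h]
  simp only [pow_two]
  linarith

/-- The trace of a projection is its rank: Parseval in `V`, interchange of the sums, Parseval in
`H`. -/
theorem HilbertBasis.tsum_norm_sq_starProjection {κ : Type*} (e₀ : HilbertBasis κ ℂ H)
    (V : Submodule ℂ H) [CompleteSpace V] {ι : Type*} (b : HilbertBasis ι ℂ V) :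
    ∑' j, ENNReal.ofReal (‖V.starProjection (e₀ j)‖ ^ 2) = ENat.card ι := by
  have h1 : ∀ j, ENNReal.ofReal (‖V.starProjection (e₀ j)‖ ^ 2) =
      ∑' i, ENNReal.ofReal (‖inner ℂ (b i : H) (e₀ j)‖ ^ 2) := by
    intro j
    have hs := b.hasSum_norm_inner_sq (V.orthogonalProjectionOnto (e₀ j))
    rw [← ENNReal.ofReal_tsum_of_nonneg]
    · rw [Submodule.starProjection_apply, ← Submodule.coe_norm, ← hs.tsum_eq]
      congr 2
      funext i
      rw [Submodule.inner_orthogonalProjectionOnto_eq_of_mem_left]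
    · exact fun _ => by positivity
    · refine hs.summable.congr fun i => ?_
      rw [Submodule.inner_orthogonalProjectionOnto_eq_of_mem_left]
  have h2 : ∀ i, ∑' j, ENNReal.ofReal (‖inner ℂ (b i : H) (e₀ j)‖ ^ 2) = 1 := by
    intro i
    have hs := e₀.hasSum_norm_inner_sq (b i : H)
    have hb : ‖(b i : H)‖ = 1 := b.orthonormal.1 i
    simp only [norm_inner_symm (b i : H)]
    rw [← ENNReal.ofReal_tsum_of_nonneg (fun _ => by positivity) hs.summable, hs.tsum_eq, hb]
    simp
  simp only [h1]
  rw [ENNReal.tsum_comm]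
  simp only [h2, ENNReal.tsum_one]

/-- A Hilbert basis adapted to a sequence of mutually orthogonal subspaces with dense span. -/
theorem exists_hilbertBasis_of_orthogonal_sequence (V : ℕ → Submodule ℂ H)
    [∀ n, CompleteSpace (V n)] (horth : ∀ m n, m ≠ n → V m ⟂ V n)
    (htop : ∀ x, (∀ n, x ∈ (V n)ᗮ) → x = 0) :
    ∃ (ι : Type u) (e : HilbertBasis ι ℂ H) (lev : ι → ℕ), (∀ i, e i ∈ V (lev i)) ∧
      ∀ {κ : Type u} (e₀ : HilbertBasis κ ℂ H) (n : ℕ),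
        ((fiberCard lev n : ℕ∞) : ENNReal) =
          ∑' j, ENNReal.ofReal (‖(V n).starProjection (e₀ j)‖ ^ 2) := by
  choose w b hb using fun n => exists_hilbertBasis ℂ (V n)
  let v : (Σ n, w n) → H := fun p => (b p.1 p.2 : H)
  have hv : Orthonormal ℂ v := by
    refine ⟨fun p => (b p.1).orthonormal.1 p.2, ?_⟩
    rintro ⟨m, i⟩ ⟨n, j⟩ hij
    rcases eq_or_ne m n with rfl | hmn
    · exact (b m).orthonormal.2 fun h => hij (congrArg (Sigma.mk m) h)
    · exact (horth m n hmn).inner_eq (b m i).2 (b n j).2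
  have hbot : (Submodule.span ℂ (Set.range v))ᗮ = ⊥ := by
    rw [Submodule.eq_bot_iff]
    intro x hx
    refine htop x fun n => ?_
    have h0 : (V n).orthogonalProjectionOnto x = 0 := by
      refine (b n).ext_inner fun i => ?_
      rw [Submodule.inner_orthogonalProjectionOnto_eq_of_mem_left, inner_zero_right]
      exact (Submodule.mem_orthogonal _ _).1 hx _ (Submodule.subset_span ⟨⟨n, i⟩, rfl⟩)
    exact Submodule.orthogonalProjectionOnto_eq_zero_iff.1 h0
  refine ⟨Σ n, w n, HilbertBasis.mkOfOrthogonalEqBot hv hbot, Sigma.fst, fun p => ?_, ?_⟩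
  · rw [HilbertBasis.coe_mkOfOrthogonalEqBot]
    exact (b p.1 p.2).2
  · intro κ e₀ n
    rw [e₀.tsum_norm_sq_starProjection (V n) (b n), fiberCard, ← ENat.card_coe_set_eq]
    congr 1
    exact (ENat.card_congr ((Equiv.ofInjective (Sigma.mk n) sigma_mk_injective).trans
      (Equiv.setCongr (Set.range_sigmaMk n)))).symm

end SpectralSubspaces

/-! ### Operator ranges as diagonal operator ranges -/

section OperatorRanges

universe u

variable {H : Type u} [NormedAddCommGroup H] [InnerProductSpace ℂ H] [CompleteSpace H]

open ContinuousLinearMap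

/-- The Douglas range inclusion lemma, for operators whose adjoint is injective. -/
theorem ContinuousLinearMap.range_subset_range_of_norm_adjoint_le {R M : H →L[ℂ] H}
    (hM : Function.Injective (adjoint M)) {C : ℝ} (h : ∀ x, ‖adjoint R x‖ ≤ C * ‖adjoint M x‖) :
    Set.range R ⊆ Set.range M := by
  rintro _ ⟨w, rfl⟩
  let E := LinearEquiv.ofInjective (adjoint M : H →ₗ[ℂ] H) hM
  -- The functional M* x ↦ ⟨w, R* x⟩ is bounded by hypothesis. A Hahn–Banach extension is
  -- represented by a vector, which `M` maps to R w.
  let φ₀ : LinearMap.range (adjoint M : H →ₗ[ℂ] H) →ₗ[ℂ] ℂ :=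
    (innerSL ℂ w : H →ₗ[ℂ] ℂ) ∘ₗ (adjoint R : H →ₗ[ℂ] H) ∘ₗ E.symm.toLinearMap
  have hφ₀ : ∀ x, φ₀ (E x) = inner ℂ w (adjoint R x) := by
    intro x
    simp [φ₀]
  let φ : LinearMap.range (adjoint M : H →ₗ[ℂ] H) →L[ℂ] ℂ := φ₀.mkContinuous (‖w‖ * C) (by
    intro y
    obtain ⟨x, rfl⟩ := E.surjective y
    rw [hφ₀]
    calc ‖inner ℂ w (adjoint R x)‖ ≤ ‖w‖ * ‖adjoint R x‖ := norm_inner_le_norm _ _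
      _ ≤ ‖w‖ * (C * ‖adjoint M x‖) := by gcongr; exact h x
      _ = _ := by rw [mul_assoc]; rfl)
  obtain ⟨ψ, hψ, -⟩ := exists_extension_norm_eq _ φ
  refine ⟨(InnerProductSpace.toDual ℂ H).symm ψ, ?_⟩
  refine ext_inner_right ℂ fun x => ?_
  rw [← adjoint_inner_right, InnerProductSpace.toDual_symm_apply, ← adjoint_inner_right, ← hφ₀]
  exact hψ (E x)

theorem HilbertBasis.adjoint_levelOp {ι : Type*} (e : HilbertBasis ι ℂ H) (lev : ι → ℕ) :
    adjoint (e.levelOp lev) = e.levelOp lev :=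
  ((eq_adjoint_iff _ _).2 fun x y => e.inner_levelOp_left lev x y).symm

theorem ContinuousLinearMap.isSelfAdjoint_mul_adjoint (R : H →L[ℂ] H) :
    IsSelfAdjoint (R * adjoint R) :=
  IsSelfAdjoint.mul_star_self R

theorem ContinuousLinearMap.re_inner_mul_adjoint (R : H →L[ℂ] H) (x : H) :
    (inner ℂ ((R * adjoint R) x) x).re = ‖adjoint R x‖ ^ 2 := by
  rw [mul_apply_eq, ← adjoint_inner_right]
  exact inner_self_eq_norm_sq (𝕜 := ℂ) _

/-- The spectral subspace of `S` for the interval `(2⁻¹ 4⁻ⁿ, 2 · 4⁻ⁿ]`. -/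
noncomputable def ContinuousLinearMap.dyadicSpace (S : H →L[ℂ] H) (n : ℕ) : Submodule ℂ H :=
  (S.lowSpace (2 * (1 / 4) ^ n)).orthogonalDiff (S.lowSpace (2 * (1 / 4) ^ (n + 1)))

instance (S : H →L[ℂ] H) (n : ℕ) : CompleteSpace (S.dyadicSpace n) :=
  inferInstanceAs (CompleteSpace ((S.lowSpace _).orthogonalDiff (S.lowSpace _)))

theorem ContinuousLinearMap.lowSpace_antitone (S : H →L[ℂ] H) {m n : ℕ} (hmn : m ≤ n) :
    S.lowSpace (2 * (1 / 4) ^ n) ≤ S.lowSpace (2 * (1 / 4) ^ m) := by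
  refine S.lowSpace_mono ?_
  gcongr ?_ * ?_
  exact pow_le_pow_of_le_one (by norm_num) (by norm_num) hmn

theorem ContinuousLinearMap.dyadicSpace_isOrtho (S : H →L[ℂ] H) {m n : ℕ} (hmn : m ≠ n) :
    S.dyadicSpace m ⟂ S.dyadicSpace n := by
  rcases hmn.lt_or_gt with h | h
  · rw [Submodule.isOrtho_iff_le]
    exact inf_le_right.trans (Submodule.orthogonal_le
      (inf_le_left.trans (S.lowSpace_antitone (Nat.succ_le_of_lt h))))
  · refine Submodule.IsOrtho.symm ?_
    rw [Submodule.isOrtho_iff_le]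
    exact inf_le_right.trans (Submodule.orthogonal_le
      (inf_le_left.trans (S.lowSpace_antitone (Nat.succ_le_of_lt h))))

/-- Such an `x` descends through all the low spaces: the first is everything because ‖S‖ ≤ 1 < 2,
and each step removes only a component in a dyadic space. Hence ‖R* x‖² = ⟨S x, x⟩ ≤ 2·4⁻ⁿ ‖x‖² for
all n. -/
theorem ContinuousLinearMap.eq_zero_of_mem_dyadicSpace_orthogonal {R : H →L[ℂ] H}
    (hR : ‖R‖ ≤ 1) (hinj : Function.Injective (adjoint R)) {x : H}
    (hx : ∀ n, x ∈ ((R * adjoint R).dyadicSpace n)ᗮ) : x = 0 := by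
  set S := R * adjoint R with hS
  have hsa : IsSelfAdjoint S := R.isSelfAdjoint_mul_adjoint
  have hn : ‖S‖ ≤ 1 := by
    refine (norm_mul_le _ _).trans ?_
    rw [show ‖adjoint R‖ = ‖R‖ from LinearIsometryEquiv.norm_map _ _]
    nlinarith [norm_nonneg R]
  have hall : ∀ n, x ∈ S.lowSpace (2 * (1 / 4) ^ n) := by
    intro n
    induction n with
    | zero =>
      rw [lowSpace_eq_top hsa (by norm_num; linarith)]
      trivial
    | succ n ih =>
      set K := S.lowSpace (2 * (1 / 4) ^ (n + 1)) with hK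
      have hq : x - K.starProjection x ∈ S.dyadicSpace n :=
        ⟨Submodule.sub_mem _ ih (S.lowSpace_antitone n.le_succ (K.starProjection_apply_mem x)),
          K.sub_starProjection_mem_orthogonal x⟩
      have h1 : inner ℂ (x - K.starProjection x) x = 0 :=
        (Submodule.mem_orthogonal _ _).1 (hx n) _ hq
      have h2 : inner ℂ (x - K.starProjection x) (K.starProjection x) = 0 :=
        (Submodule.mem_orthogonal' _ _).1 hq.2 _ (K.starProjection_apply_mem x)
      have h3 : inner ℂ (x - K.starProjection x) (x - K.starProjection x) = 0 := by
        rw [inner_sub_right, h1, h2, sub_zero]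
      rw [sub_eq_zero.1 (inner_self_eq_zero.1 h3)]
      exact K.starProjection_apply_mem x
  have hlim := ((tendsto_pow_atTop_nhds_zero_of_lt_one (r := (1 / 4 : ℝ)) (by norm_num)
    (by norm_num)).const_mul 2).mul_const (‖x‖ ^ 2)
  rw [mul_zero, zero_mul] at hlim
  have h0 : ‖adjoint R x‖ ^ 2 ≤ 0 := ge_of_tendsto' hlim fun n => by
    rw [← re_inner_mul_adjoint]
    exact re_inner_le_of_mem_lowSpace hsa (hall n)
  refine hinj ?_
  rw [map_zero]
  exact norm_eq_zero.1 (pow_eq_zero_iff two_ne_zero |>.1 (le_antisymm h0 (by positivity)))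

/-- On the dyadic decomposition, `R R*` is comparable with the square of the level operator. -/
theorem ContinuousLinearMap.norm_adjoint_comparison (R : H →L[ℂ] H) {ι : Type*}
    (e : HilbertBasis ι ℂ H) {lev : ι → ℕ}
    (he : ∀ i, e i ∈ (R * adjoint R).dyadicSpace (lev i)) (x : H) :
    ‖adjoint R x‖ ≤ 2 * ‖e.levelOp lev x‖ ∧ ‖e.levelOp lev x‖ ≤ 2 * ‖adjoint R x‖ := by
  classical
  set S := R * adjoint R with hS
  have hsa : IsSelfAdjoint S := R.isSelfAdjoint_mul_adjoint
  -- both sides are continuous, so a dense subspace suffices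
  have hdense : Dense ((⨆ n, S.dyadicSpace n : Submodule ℂ H) : Set H) := by
    have h1 : Submodule.span ℂ (Set.range e) ≤ ⨆ n, S.dyadicSpace n := by
      rw [Submodule.span_le]
      rintro _ ⟨i, rfl⟩
      exact Submodule.mem_iSup_of_mem (lev i) (he i)
    rw [Submodule.dense_iff_topologicalClosure_eq_top, ← top_le_iff, ← e.dense_span]
    exact Submodule.topologicalClosure_mono h1
  refine hdense.induction (P := fun x => ‖adjoint R x‖ ≤ 2 * ‖e.levelOp lev x‖ ∧
    ‖e.levelOp lev x‖ ≤ 2 * ‖adjoint R x‖) ?_ ?_ x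
  · intro x hx
    obtain ⟨f, hf, rfl⟩ := (Submodule.mem_iSup_iff_exists_finsupp _ _).1 hx
    have hlev : ∀ n, e.levelOp lev (f n) = (((1 / 2) ^ n : ℝ) : ℂ) • f n := by
      intro n
      refine e.ext_inner fun i => ?_
      rw [e.inner_levelOp, inner_smul_right]
      by_cases h : lev i = n
      · rw [h]
      · rw [(S.dyadicSpace_isOrtho h).inner_eq (he i) (hf n), mul_zero, mul_zero]
    have hSmem : ∀ n, S (f n) ∈ S.dyadicSpace n := fun n =>
      ⟨apply_mem_lowSpace hsa (hf n).1, apply_mem_lowSpace_orthogonal hsa (hf n).2⟩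
    have key : ∀ g h : ℕ → H, (∀ n, g n ∈ S.dyadicSpace n) → (∀ n, h n ∈ S.dyadicSpace n) →
        inner ℂ (∑ n ∈ f.support, g n) (∑ n ∈ f.support, h n) =
          ∑ n ∈ f.support, inner ℂ (g n) (h n) := by
      intro g h hg hh
      rw [sum_inner]
      refine Finset.sum_congr rfl fun m hm => ?_
      rw [inner_sum, Finset.sum_eq_single m]
      · intro n _ hnm
        exact (S.dyadicSpace_isOrtho hnm.symm).inner_eq (hg m) (hh n)
      · exact fun h => absurd hm h
    have hA : ‖adjoint R (f.sum fun _ xi => xi)‖ ^ 2 =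
        ∑ n ∈ f.support, (inner ℂ (S (f n)) (f n)).re := by
      rw [← re_inner_mul_adjoint, Finsupp.sum, map_sum, key _ _ hSmem hf, Complex.re_sum]
    have hB : ‖e.levelOp lev (f.sum fun _ xi => xi)‖ ^ 2 =
        ∑ n ∈ f.support, (1 / 4) ^ n * ‖f n‖ ^ 2 := by
      rw [← inner_self_eq_norm_sq (𝕜 := ℂ), Finsupp.sum, map_sum]
      simp only [hlev]
      rw [key _ _ (fun n => Submodule.smul_mem _ _ (hf n)) (fun n => Submodule.smul_mem _ _ (hf n)),
        map_sum]
      refine Finset.sum_congr rfl fun n _ => ?_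
      rw [inner_self_eq_norm_sq, norm_smul, mul_pow, Complex.norm_real,
        Real.norm_of_nonneg (by positivity), ← pow_mul, mul_comm n 2, pow_mul]
      norm_num
    -- On the n-th piece 4⁻ⁿ/2 ≤ S ≤ 2·4⁻ⁿ. The squared norms thus compare with constant 2, and the
    -- norms with the cruder 2 in place of √2.
    have hle : ∑ n ∈ f.support, (inner ℂ (S (f n)) (f n)).re ≤
        2 * ∑ n ∈ f.support, (1 / 4) ^ n * ‖f n‖ ^ 2 := by
      rw [Finset.mul_sum]
      refine Finset.sum_le_sum fun n _ => ?_
      rw [← mul_assoc]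
      exact re_inner_le_of_mem_lowSpace hsa (hf n).1
    have hge : ∑ n ∈ f.support, (1 / 4) ^ n * ‖f n‖ ^ 2 ≤
        2 * ∑ n ∈ f.support, (inner ℂ (S (f n)) (f n)).re := by
      rw [Finset.mul_sum]
      refine Finset.sum_le_sum fun n _ => ?_
      have := le_re_inner_of_mem_lowSpace_orthogonal hsa (hf n).2
      rw [pow_succ] at this
      linarith
    rw [← hA, ← hB] at hle hge
    constructor
    · refine le_of_sq_le_sq ?_ (by positivity)
      nlinarith [sq_nonneg ‖e.levelOp lev (f.sum fun _ xi => xi)‖]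
    · refine le_of_sq_le_sq ?_ (by positivity)
      nlinarith [sq_nonneg ‖adjoint R (f.sum fun _ xi => xi)‖]
  · exact (isClosed_le (f := fun x => ‖adjoint R x‖) (g := fun x => 2 * ‖e.levelOp lev x‖)
      (by fun_prop) (by fun_prop)).inter
      (isClosed_le (f := fun x => ‖e.levelOp lev x‖) (g := fun x => 2 * ‖adjoint R x‖)
      (by fun_prop) (by fun_prop))

/-- The range of a contraction with injective adjoint is the range of a level operator, with
multiplicities given by the dyadic spectral subspaces of `R R*`. -/
theorem ContinuousLinearMap.exists_range_eq_range_levelOp {R : H →L[ℂ] H} (hR : ‖R‖ ≤ 1)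
    (hinj : Function.Injective (adjoint R)) :
    ∃ (ι : Type u) (e : HilbertBasis ι ℂ H) (lev : ι → ℕ),
      Set.range R = Set.range (e.levelOp lev) ∧
      ∀ {κ : Type u} (e₀ : HilbertBasis κ ℂ H) (n : ℕ),
        ((fiberCard lev n : ℕ∞) : ENNReal) =
          ∑' j, ENNReal.ofReal (‖((R * adjoint R).lowSpace (2 * (1 / 4) ^ n)).starProjection
              (e₀ j)‖ ^ 2 -
            ‖((R * adjoint R).lowSpace (2 * (1 / 4) ^ (n + 1))).starProjection (e₀ j)‖ ^ 2) := by
  obtain ⟨ι, e, lev, he, hcard⟩ := exists_hilbertBasis_of_orthogonal_sequence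
    (R * adjoint R).dyadicSpace (fun m n h => dyadicSpace_isOrtho _ h)
    (fun x hx => eq_zero_of_mem_dyadicSpace_orthogonal hR hinj hx)
  refine ⟨ι, e, lev, ?_, fun e₀ n => ?_⟩
  · have h := R.norm_adjoint_comparison e he
    refine Set.Subset.antisymm ?_ ?_
    · refine range_subset_range_of_norm_adjoint_le (C := 2) ?_ fun x => ?_
      · rw [e.adjoint_levelOp]
        exact e.levelOp_injective lev
      · rw [e.adjoint_levelOp]
        exact (h x).1
    · refine range_subset_range_of_norm_adjoint_le (C := 2) hinj fun x => ?_
      rw [e.adjoint_levelOp]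
      exact (h x).2
  · rw [hcard e₀ n]
    refine tsum_congr fun j => ?_
    rw [← Submodule.norm_sq_starProjection_orthogonalDiff (lowSpace_antitone _ n.le_succ)]
    rfl

end OperatorRanges

/-! ### Resolvents of self-adjoint operators -/

namespace SA

open ContinuousLinearMap

variable {H : Type*} [NormedAddCommGroup H] [InnerProductSpace ℂ H] [CompleteSpace H]

theorem resolvent_subI (A : SA H) (x : A.dom) : A.resolvent (A.subI x) = x := by
  have h : (LinearEquiv.ofBijective A.subI A.subI_bijective).symm (A.subI x) = x :=
    (LinearEquiv.ofBijective A.subI A.subI_bijective).symm_apply_apply x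
  exact congrArg Subtype.val h

theorem range_resolvent (A : SA H) : Set.range A.resolvent = (A.dom : Set H) := by
  ext y
  constructor
  · rintro ⟨ξ, rfl⟩
    obtain ⟨x, rfl⟩ := A.subI_bijective.2 ξ
    rw [resolvent_subI]
    exact x.2
  · intro hy
    exact ⟨A.subI ⟨y, hy⟩, A.resolvent_subI ⟨y, hy⟩⟩

theorem norm_resolvent_le (A : SA H) : ‖A.resolvent‖ ≤ 1 :=
  LinearMap.mkContinuous_norm_le _ zero_le_one _

/-- This says (A + i) R* = 1: the pairing with A w is bounded in w, so R* x lies in dom A* = dom A.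
-/
theorem exists_adjoint_resolvent (A : SA H) (x : H) :
    ∃ y : A.dom, (y : H) = adjoint A.resolvent x ∧ A.1 y = x - I • adjoint A.resolvent x := by
  have h1 : ∀ w : A.dom, inner ℂ (x - I • adjoint A.resolvent x) (w : H) =
      inner ℂ (adjoint A.resolvent x) (A.1 w) := by
    intro w
    have h := adjoint_inner_left A.resolvent (A.subI w) x
    rw [resolvent_subI, subI_apply, inner_sub_right, inner_smul_right] at h
    rw [inner_sub_left, inner_smul_left, Complex.conj_I, ← h]
    ring
  have hadj := LinearPMap.isSelfAdjoint_def.1 A.2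
  have hy1 : adjoint A.resolvent x ∈ A.1.adjoint.domain :=
    A.1.mem_adjoint_domain_of_exists _ ⟨_, h1⟩
  have hy2 : adjoint A.resolvent x ∈ A.dom := by rw [hadj] at hy1; exact hy1
  refine ⟨⟨_, hy2⟩, rfl, ?_⟩
  refine A.2.dense_domain.eq_of_inner_left (𝕜 := ℂ) fun w hw => ?_
  rw [h1 ⟨w, hw⟩]
  exact A.symm ⟨_, hy2⟩ ⟨w, hw⟩

theorem adjoint_resolvent_injective (A : SA H) : Function.Injective (adjoint A.resolvent) := by
  rw [injective_iff_map_eq_zero]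
  intro x hx
  obtain ⟨y, hy1, hy2⟩ := A.exists_adjoint_resolvent x
  rw [hx] at hy1 hy2
  have hy0 : y = 0 := Subtype.ext hy1
  rw [hy0, smul_zero, sub_zero] at hy2
  exact hy2.symm.trans (LinearPMap.map_zero _)

/-- The resolvent identity between i and -i. -/
theorem adjoint_resolvent_apply (A : SA H) (x : H) :
    adjoint A.resolvent x = A.resolvent x - (2 * I) • A.resolvent (adjoint A.resolvent x) := by
  obtain ⟨y, hy1, hy2⟩ := A.exists_adjoint_resolvent x
  have h : A.subI y = x - (2 * I) • adjoint A.resolvent x := by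
    rw [subI_apply, hy2, hy1, mul_smul, two_smul]
    abel
  have h2 := A.resolvent_subI y
  rw [h, hy1, map_sub, map_smul] at h2
  exact h2.symm

theorem adjoint_resolvent_add (A : SA H) (y : A.dom) :
    adjoint A.resolvent (A.1 y + I • (y : H)) = y := by
  refine ext_inner_right ℂ fun z => ?_
  obtain ⟨w, rfl⟩ := A.subI_bijective.2 z
  rw [adjoint_inner_left, resolvent_subI, subI_apply, inner_add_left, inner_sub_right,
    inner_smul_left, inner_smul_right, Complex.conj_I, A.symm]
  ring

/-- Both orders of the resolvent identity give R - R*, so the resolvent is normal. Normality makes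
taking the adjoint strongly continuous here, as used in `stronglyContinuous_adjoint_resolvent`. -/
theorem resolvent_commute_adjoint (A : SA H) (x : H) :
    A.resolvent (adjoint A.resolvent x) = adjoint A.resolvent (A.resolvent x) := by
  obtain ⟨y, rfl⟩ := A.subI_bijective.2 x
  have h1 := A.adjoint_resolvent_apply (A.subI y)
  have h2 := A.adjoint_resolvent_add y
  have h3 : A.1 y + I • (y : H) = A.subI y + (2 * I) • (y : H) := by
    rw [subI_apply, mul_smul, two_smul]
    abel
  rw [h3, map_add, map_smul] at h2
  rw [resolvent_subI] at h1 ⊢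
  have h4 : (2 * I) • A.resolvent (adjoint A.resolvent (A.subI y)) =
      (2 * I) • adjoint A.resolvent (y : H) := by
    rw [eq_sub_iff_add_eq] at h1
    exact add_left_cancel (h1.trans h2.symm)
  exact smul_right_injective H (by simp : (2 * I) ≠ 0) h4

theorem norm_adjoint_resolvent (A : SA H) (x : H) :
    ‖adjoint A.resolvent x‖ = ‖A.resolvent x‖ := by
  have h1 : inner ℂ (adjoint A.resolvent x) (adjoint A.resolvent x) =
      inner ℂ (A.resolvent x) (A.resolvent x) := by
    rw [adjoint_inner_left, resolvent_commute_adjoint, adjoint_inner_right]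
  rw [inner_self_eq_norm_sq_to_K, inner_self_eq_norm_sq_to_K] at h1
  have h2 : ‖adjoint A.resolvent x‖ ^ 2 = ‖A.resolvent x‖ ^ 2 := by exact_mod_cast h1
  exact (sq_eq_sq₀ (norm_nonneg _) (norm_nonneg _)).1 h2

end SA

/-! ### Strongly continuous families of operators -/

section StrongContinuity

open ContinuousLinearMap Filter Topology

variable {H : Type*} [NormedAddCommGroup H] [InnerProductSpace ℂ H] [CompleteSpace H]
variable {X : Type*} [TopologicalSpace X]

/-- A family of operators is strongly continuous in its parameter. -/
def StronglyContinuous (F : X → H →L[ℂ] H) : Prop := ∀ x, Continuous fun a => F a x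

theorem StronglyContinuous.mul {F G : X → H →L[ℂ] H} (hF : StronglyContinuous F)
    (hG : StronglyContinuous G) {c : ℝ} (hc : ∀ a, ‖F a‖ ≤ c) :
    StronglyContinuous fun a => F a * G a := by
  intro x
  rw [continuous_iff_continuousAt]
  intro a₀
  have h1 : Tendsto (fun a => F a (G a x - G a₀ x)) (𝓝 a₀) (𝓝 0) := by
    have h0 : Tendsto (fun a => c * ‖G a x - G a₀ x‖) (𝓝 a₀) (𝓝 0) := by
      have : Continuous fun a => c * ‖G a x - G a₀ x‖ :=
        continuous_const.mul ((hG x).sub continuous_const).norm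
      simpa using this.tendsto a₀
    exact squeeze_zero_norm (fun a => ((F a).le_opNorm _).trans (by gcongr; exact hc a)) h0
  have h2 := h1.add ((hF (G a₀ x)).tendsto a₀)
  rw [zero_add] at h2
  refine h2.congr fun a => ?_
  rw [map_sub, sub_add_cancel, mul_apply_eq]

theorem StronglyContinuous.aeval {F : X → H →L[ℂ] H} (hF : StronglyContinuous F) {c : ℝ}
    (hc : ∀ a, ‖F a‖ ≤ c) (p : Polynomial ℝ) :
    StronglyContinuous fun a => Polynomial.aeval (F a) p := by
  induction p using Polynomial.induction_on with
  | C r =>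
    intro x
    simp only [Polynomial.aeval_C]
    exact continuous_const
  | add p q hp hq =>
    intro x
    simp only [map_add]
    exact (hp x).add (hq x)
  | monomial n r h =>
    intro x
    refine (hF.mul h hc x).congr fun a => ?_
    congr 1
    simp only [map_mul, Polynomial.aeval_C, map_pow, Polynomial.aeval_X, pow_succ']
    rw [← mul_assoc, ← mul_assoc, Algebra.commutes]

/-- All the spectra lie in [-1, 1], so Weierstrass approximation by polynomials is uniform over the
family. -/
theorem StronglyContinuous.cfc {F : X → H →L[ℂ] H} (hF : StronglyContinuous F)
    (hsa : ∀ a, IsSelfAdjoint (F a)) (hc : ∀ a, ‖F a‖ ≤ 1) {f : ℝ → ℝ} (hf : Continuous f) :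
    StronglyContinuous fun a => cfc f (F a) := by
  intro x
  refine continuous_of_uniform_approx_of_continuous fun u hu => ?_
  obtain ⟨ε, hε, hεu⟩ := Metric.mem_uniformity_dist.1 hu
  set δ := ε / (‖x‖ + 1) with hδ
  have hδ0 : 0 < δ := by positivity
  obtain ⟨p, hp⟩ := exists_polynomial_near_of_continuousOn (-1) 1 f hf.continuousOn δ hδ0
  refine ⟨fun a => Polynomial.aeval (F a) p x, hF.aeval hc p x, fun a => hεu ?_⟩
  have hspec : ∀ r ∈ spectrum ℝ (F a), r ∈ Set.Icc (-1 : ℝ) 1 := by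
    intro r hr
    have h1 := spectrum.norm_le_norm_mul_of_mem hr
    have h2 : ‖(1 : H →L[ℂ] H)‖ ≤ 1 := ContinuousLinearMap.norm_id_le
    have h3 : ‖r‖ ≤ 1 := h1.trans (mul_le_one₀ (hc a) (norm_nonneg _) h2)
    exact abs_le.1 h3
  have hnorm : ‖_root_.cfc f (F a) - Polynomial.aeval (F a) p‖ ≤ δ := by
    rw [← cfc_polynomial p (F a) (hsa a), ← cfc_sub _ _ _ (by fun_prop) (by fun_prop)]
    refine norm_cfc_le hδ0.le fun r hr => ?_
    rw [norm_sub_rev]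
    exact (hp r (hspec r hr)).le
  rw [dist_eq_norm, ← _root_.sub_apply]
  calc _ ≤ δ * ‖x‖ := ((_root_.cfc f (F a) - Polynomial.aeval (F a) p).le_opNorm x).trans
        (by gcongr)
    _ < δ * (‖x‖ + 1) := by gcongr; linarith
    _ = ε := by rw [hδ]; field_simp

theorem StronglyContinuous.of_hilbertBasis {F : X → H →L[ℂ] H} {c : ℝ} (hc : ∀ a, ‖F a‖ ≤ c)
    {ι : Type*} (e : HilbertBasis ι ℂ H) (he : ∀ i, Continuous fun a => F a (e i)) :
    StronglyContinuous F := by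
  intro x
  let V : Submodule ℂ H :=
    { carrier := {x | Continuous fun a => F a x}
      add_mem' := fun {x y} hx hy => by
        simp only [Set.mem_ofPred_eq, map_add] at *
        exact hx.add hy
      zero_mem' := by simpa using continuous_const
      smul_mem' := fun r x hx => by
        simp only [Set.mem_ofPred_eq, map_smul] at *
        exact hx.const_smul r }
  have hV : Submodule.span ℂ (Set.range e) ≤ V := by
    rw [Submodule.span_le]
    rintro _ ⟨i, rfl⟩
    exact he i
  refine continuous_of_uniform_approx_of_continuous fun u hu => ?_
  obtain ⟨ε, hε, hεu⟩ := Metric.mem_uniformity_dist.1 hu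
  have hx : x ∈ closure (Submodule.span ℂ (Set.range e) : Set H) := by
    rw [← Submodule.topologicalClosure_coe, e.dense_span]
    trivial
  obtain ⟨y, hy, hxy⟩ := Metric.mem_closure_iff.1 hx (ε / (|c| + 1)) (by positivity)
  refine ⟨fun a => F a y, hV hy, fun a => hεu ?_⟩
  rw [dist_eq_norm] at hxy ⊢
  rw [← map_sub]
  calc ‖F a (x - y)‖ ≤ |c| * ‖x - y‖ :=
        ((F a).le_opNorm _).trans (by gcongr; exact (hc a).trans (le_abs_self c))
    _ ≤ (|c| + 1) * ‖x - y‖ := by gcongr; linarith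
    _ < (|c| + 1) * (ε / (|c| + 1)) := by gcongr
    _ = ε := by field_simp

theorem stronglyContinuous_iff {F : X → H →L[ℂ] H} : StronglyContinuous F ↔
    Continuous fun a => toPointwiseConvergenceCLM ℂ (RingHom.id ℂ) H H (F a) := by
  rw [(PointwiseConvergenceCLM.isEmbedding_coeFn (RingHom.id ℂ) H H).continuous_iff, continuous_pi_iff]
  rfl

end StrongContinuity

/-! ### From self-adjoint operators to sequences -/

section Countability

variable {H : Type*} [NormedAddCommGroup H] [InnerProductSpace ℂ H]

theorem HilbertBasis.countable_index [TopologicalSpace.SeparableSpace H] {ι : Type*}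
    (e : HilbertBasis ι ℂ H) : Countable ι := by
  refine Pairwise.countable_of_isOpen_disjoint (s := fun i => Metric.ball (e i) (1 / 2)) ?_
    (fun _ => Metric.isOpen_ball) fun i => ⟨e i, Metric.mem_ball_self (by norm_num)⟩
  intro i j hij
  refine Metric.ball_disjoint_ball ?_
  have h : ‖e i - e j‖ ^ 2 = 2 := by
    rw [norm_sub_sq (𝕜 := ℂ), e.orthonormal.2 hij, e.orthonormal.1, e.orthonormal.1]
    norm_num
  rw [dist_eq_norm]
  nlinarith [norm_nonneg (e i - e j)]

theorem HilbertBasis.infinite_index (h : ¬ FiniteDimensional ℂ H) {ι : Type*}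
    (e : HilbertBasis ι ℂ H) : Infinite ι := by
  by_contra hfin
  rw [not_infinite_iff_finite] at hfin
  have := Fintype.ofFinite ι
  exact h (Module.Finite.of_basis e.toOrthonormalBasis.toBasis)

instance : BorelSpace ℕ∞ := by
  refine ⟨le_antisymm (fun s _ => ?_) le_top⟩
  have h1 : ∀ x : ℕ∞, @MeasurableSet ℕ∞ (borel ℕ∞) {x} := fun x => by
    have h : @MeasurableSet ℕ∞ (borel ℕ∞) {x}ᶜ :=
      MeasurableSpace.measurableSet_generateFrom (isOpen_compl_singleton : IsOpen ({x}ᶜ : Set ℕ∞))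
    simpa using h.compl
  rw [← Set.biUnion_of_singleton s]
  exact @MeasurableSet.biUnion _ _ (borel ℕ∞) _ s (Set.to_countable s) fun x _ => h1 x

end Countability

namespace SA

open ContinuousLinearMap

universe u
variable {H : Type u} [NormedAddCommGroup H] [InnerProductSpace ℂ H] [CompleteSpace H]

theorem stronglyContinuous_resolvent : StronglyContinuous (resolvent : SA H → H →L[ℂ] H) :=
  stronglyContinuous_iff.2 continuous_induced_dom

/-- Expanding the square of the difference, normality turns ‖R* x‖ into ‖R x‖, and every term
becomes continuous in the operator. -/
theorem stronglyContinuous_adjoint_resolvent :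
    StronglyContinuous fun A : SA H => adjoint A.resolvent := by
  intro x
  rw [continuous_iff_continuousAt]
  intro B
  rw [ContinuousAt, tendsto_iff_norm_sub_tendsto_zero]
  have h1 : ∀ A : SA H, ‖adjoint A.resolvent x - adjoint B.resolvent x‖ ^ 2 =
      ‖A.resolvent x‖ ^ 2 - 2 * (inner ℂ x (A.resolvent (adjoint B.resolvent x))).re +
        ‖B.resolvent x‖ ^ 2 := by
    intro A
    rw [norm_sub_sq (𝕜 := ℂ), norm_adjoint_resolvent, norm_adjoint_resolvent, adjoint_inner_left]
    rfl
  have hA := stronglyContinuous_resolvent (H := H)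
  have h2 : Continuous fun A : SA H => ‖adjoint A.resolvent x - adjoint B.resolvent x‖ ^ 2 := by
    simp only [h1]
    refine (((hA x).norm.pow 2).sub (continuous_const.mul (Complex.continuous_re.comp ?_))).add
      continuous_const
    exact continuous_const.inner (hA _)
  have h3 := (Real.continuous_sqrt.comp h2).tendsto B
  simpa [Function.comp_def] using h3

/-- The operator `(A² + 1)⁻¹`. -/
noncomputable def sqResolvent (A : SA H) : H →L[ℂ] H := A.resolvent * adjoint A.resolvent

theorem stronglyContinuous_excess (t : ℝ) :
    StronglyContinuous fun A : SA H => A.sqResolvent.excess t := by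
  refine StronglyContinuous.cfc ?_ (fun A => isSelfAdjoint_mul_adjoint _) (fun A => ?_)
    (by fun_prop)
  · exact stronglyContinuous_resolvent.mul stronglyContinuous_adjoint_resolvent
      norm_resolvent_le
  · refine (norm_mul_le _ _).trans ?_
    rw [show ‖adjoint A.resolvent‖ = ‖A.resolvent‖ from LinearIsometryEquiv.norm_map _ _]
    nlinarith [norm_nonneg A.resolvent, A.norm_resolvent_le]

theorem measurable_norm_starProjection (t : ℝ) (x : H) :
    @Measurable (SA H) ℝ (borel _) _
      fun A => ‖(A.sqResolvent.lowSpace t).starProjection x‖ := by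
  let _ : MeasurableSpace (SA H) := borel _
  have : BorelSpace (SA H) := ⟨rfl⟩
  refine measurable_of_Iio fun r => IsOpen.measurableSet ?_
  have : (fun A : SA H => ‖(A.sqResolvent.lowSpace t).starProjection x‖) ⁻¹' Set.Iio r =
      ⋃ y, {A | ‖x - A.sqResolvent.excess t y‖ < r} := by
    ext A
    simp [norm_starProjection_lowSpace_lt_iff]
  rw [this]
  exact isOpen_iUnion fun y => isOpen_lt
    (continuous_const.sub (stronglyContinuous_excess t y)).norm continuous_const

theorem exists_level_basis (A : SA H) :
    ∃ (ι : Type u) (e : HilbertBasis ι ℂ H) (lev : ι → ℕ),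
      (A.dom : Set H) = Set.range (e.levelOp lev) ∧
      ∀ {κ : Type u} (e₀ : HilbertBasis κ ℂ H) (n : ℕ),
        ((fiberCard lev n : ℕ∞) : ENNReal) =
          ∑' j, ENNReal.ofReal
            (‖(A.sqResolvent.lowSpace (2 * (1 / 4) ^ n)).starProjection (e₀ j)‖ ^ 2 -
              ‖(A.sqResolvent.lowSpace (2 * (1 / 4) ^ (n + 1))).starProjection (e₀ j)‖ ^ 2) := by
  rw [← A.range_resolvent]
  exact exists_range_eq_range_levelOp A.norm_resolvent_le A.adjoint_resolvent_injective

theorem borelReducible_esigma₀ [TopologicalSpace.SeparableSpace H]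
    (hH : ¬ FiniteDimensional ℂ H) : BorelReducible (EDomU H) ESigma₀ := by
  choose ι e lev hdom hcard using fun A : SA H => A.exists_level_basis
  have hcount : ∀ A, Countable (ι A) := fun A => (e A).countable_index
  have hinf : ∀ A, Infinite (ι A) := fun A => (e A).infinite_index hH
  refine ⟨fun A => ⟨fiberCard (lev A), tsum_fiberCard_eq_top (lev A)⟩, ?_, fun A B => ?_⟩
  · let _ : MeasurableSpace (SA H) := borel _
    have : BorelSpace (SA H) := ⟨rfl⟩
    rw [← BorelSpace.measurable_eq (α := SeqX₀)]
    refine Measurable.subtype_mk (measurable_pi_lambda _ fun n => ?_)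
    -- One fixed basis computes the multiplicities of all operators, however the adapted bases were
    -- chosen.
    obtain ⟨w, e₀, -⟩ := exists_hilbertBasis ℂ H
    have hw : Countable w := e₀.countable_index
    have hm : Measurable fun A : SA H => ((fiberCard (lev A) n : ℕ∞) : ENNReal) := by
      simp only [fun A => hcard A e₀ n]
      refine Measurable.tsum fun j => Measurable.ennreal_ofReal ?_
      exact ((measurable_norm_starProjection _ _).pow_const 2).sub
        ((measurable_norm_starProjection _ _).pow_const 2)
    refine measurable_to_countable' fun m => ?_
    have : (fun A : SA H => fiberCard (lev A) n) ⁻¹' {m} =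
        (fun A : SA H => ((fiberCard (lev A) n : ℕ∞) : ENNReal)) ⁻¹' {(m : ENNReal)} := by
      ext A
      simp
    rw [this]
    exact hm (measurableSet_singleton _)
  · change (∃ u : unitary (H →L[ℂ] H), (u : H →L[ℂ] H) '' (A.dom : Set H) = (B.dom : Set H)) ↔ _
    rw [hdom A, hdom B, (e A).exists_unitary_image_eq_iff (e B)]
    rfl

end SA

/-! ### From sequences to self-adjoint operators -/

section Enumeration

/-- The pairs `(n, i)` with `i < a n`, encoded as natural numbers. -/
def SeqX.pairs (a : SeqX) (j : ℕ) : Prop := ((Nat.unpair j).2 : ℕ∞) < a (Nat.unpair j).1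

open Classical in
/-- An enumeration in which every level `n` occurs `a n` times. -/
noncomputable def SeqX.level (a : SeqX) (j : ℕ) : ℕ := (Nat.unpair (Nat.nth a.pairs j)).1

theorem ENat.encard_setOf_lt (c : ℕ∞) : {i : ℕ | (i : ℕ∞) < c}.encard = c := by
  induction c using ENat.recTopCoe with
  | top => simp [Set.encard_univ]
  | coe k => simpa using Set.Nat.encard_range k

theorem SeqX.pairs_inter_level (a : SeqX) (n : ℕ) :
    {j | a.pairs j ∧ (Nat.unpair j).1 = n} = Nat.pair n '' {i | (i : ℕ∞) < a n} := by
  ext j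
  simp only [SeqX.pairs, Set.mem_ofPred_eq, Set.mem_image]
  constructor
  · rintro ⟨h, rfl⟩
    exact ⟨_, h, Nat.pair_unpair j⟩
  · rintro ⟨i, hi, rfl⟩
    simpa [Nat.unpair_pair] using hi

/-- Finitely many pairs would leave finitely many nonzero terms, all finite. Membership in X₀ thus
makes the enumeration of levels total and injective. -/
theorem SeqX.infinite_pairs {a : SeqX} (ha : a ∈ SeqX₀) : {j | a.pairs j}.Infinite := by
  intro hfin
  have hcard : ∀ n, a n = {j | a.pairs j ∧ (Nat.unpair j).1 = n}.encard := by
    intro n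
    rw [SeqX.pairs_inter_level, Set.InjOn.encard_image, ENat.encard_setOf_lt]
    intro i _ j _ hij
    exact (Nat.pair_eq_pair.1 hij).2
  have h0 : ∀ n ∉ hfin.toFinset.image (fun j => (Nat.unpair j).1), a n = 0 := by
    intro n hn
    rw [hcard, Set.encard_eq_zero, Set.eq_empty_iff_forall_notMem]
    rintro j ⟨hj, rfl⟩
    exact hn (Finset.mem_image_of_mem (fun j => (Nat.unpair j).1) (hfin.mem_toFinset.2 hj))
  have hsum : ∑' n, a n = ⊤ := ha
  rw [tsum_eq_sum h0] at hsum
  obtain ⟨n, -, hn⟩ := WithTop.sum_eq_top.1 hsum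
  have hlt : a n < ⊤ := by
    rw [hcard, Set.encard_lt_top_iff]
    exact hfin.subset fun j hj => hj.1
  exact hlt.ne hn

theorem SeqX.fiberCard_level {a : SeqX} (ha : a ∈ SeqX₀) : fiberCard a.level = a := by
  have hinf := SeqX.infinite_pairs ha
  funext n
  have h : Nat.nth a.pairs '' (a.level ⁻¹' {n}) = {j | a.pairs j ∧ (Nat.unpair j).1 = n} := by
    ext j
    constructor
    · rintro ⟨i, hi, rfl⟩
      exact ⟨Nat.nth_mem_of_infinite hinf i, hi⟩
    · rintro ⟨hj, hjn⟩
      have hj' : j ∈ {j | a.pairs j} := hj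
      obtain ⟨i, rfl⟩ := Nat.subset_range_nth hj'
      exact ⟨i, hjn, rfl⟩
  rw [fiberCard, ← (Nat.nth_injective hinf).encard_image, h, SeqX.pairs_inter_level,
    Set.InjOn.encard_image, ENat.encard_setOf_lt]
  intro i _ j _ hij
  exact (Nat.pair_eq_pair.1 hij).2

theorem SeqX.isClopen_pairs (j : ℕ) : IsClopen {a : SeqX | a.pairs j} := by
  have h : IsClopen (Set.Ioi ((Nat.unpair j).2 : ℕ∞)) := by
    refine ⟨?_, isOpen_Ioi⟩
    have : Set.Ioi ((Nat.unpair j).2 : ℕ∞) = Set.Ici ((Nat.unpair j).2 + 1 : ℕ∞) := by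
      ext x
      simp [ENat.add_one_le_iff]
    rw [this]
    exact isClosed_Ici
  exact h.preimage (continuous_apply _)

/-- The j-th pair is decided by the membership of finitely many codes, each a clopen condition on
the sequence. -/
theorem SeqX.eventually_level_eq {a : SeqX} (ha : a ∈ SeqX₀) (j : ℕ) :
    ∀ᶠ b in nhds a, b.level j = a.level j := by
  classical
  have hinf := SeqX.infinite_pairs ha
  set N := Nat.nth a.pairs j with hN
  have h1 : ∀ᶠ b in nhds a, ∀ i ∈ Finset.range (N + 1), b.pairs i ↔ a.pairs i := by
    rw [Filter.eventually_all_finset]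
    intro i _
    by_cases hi : a.pairs i
    · filter_upwards [(SeqX.isClopen_pairs i).isOpen.mem_nhds hi] with b hb
      exact iff_of_true hb hi
    · filter_upwards [(SeqX.isClopen_pairs i).compl.isOpen.mem_nhds hi] with b hb
      exact iff_of_false hb hi
  filter_upwards [h1] with b hb
  have hbN : b.pairs N := (hb N (by simp)).2 (Nat.nth_mem_of_infinite hinf j)
  have hcount : Nat.count b.pairs N = j := by
    rw [← Nat.count_nth_of_infinite hinf j, ← hN, Nat.count_eq_card_filter_range,
      Nat.count_eq_card_filter_range]
    congr 1
    refine Finset.filter_congr fun i hi => hb i ?_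
    rw [Finset.mem_range] at hi ⊢
    omega
  have h2 := Nat.nth_count hbN
  rw [hcount] at h2
  rw [SeqX.level, SeqX.level, ← hN, h2]

end Enumeration

/-! ### Inverses of injective symmetric operators -/

section InverseOperators

variable {H : Type*} [NormedAddCommGroup H] [InnerProductSpace ℂ H] [CompleteSpace H]

theorem LinearMap.IsSymmetric.dense_range {T : H →ₗ[ℂ] H} (hT : T.IsSymmetric)
    (hinj : Function.Injective T) : Dense (LinearMap.range T : Set H) := by
  rw [Submodule.dense_iff_topologicalClosure_eq_top, Submodule.topologicalClosure_eq_top_iff,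
    Submodule.eq_bot_iff]
  intro y hy
  refine hinj ?_
  rw [map_zero]
  refine ext_inner_right ℂ fun x => ?_
  rw [hT, inner_zero_left]
  exact (Submodule.mem_orthogonal' _ _).1 hy _ (LinearMap.mem_range_self T x)

/-- The inverse of an injective operator, defined on its range. -/
noncomputable def LinearMap.inversePMap (T : H →ₗ[ℂ] H) (hinj : Function.Injective T) :
    H →ₗ.[ℂ] H where
  domain := LinearMap.range T
  toFun := (LinearEquiv.ofInjective T hinj).symm.toLinearMap

theorem LinearMap.inversePMap_apply (T : H →ₗ[ℂ] H) (hinj : Function.Injective T) (x : H)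
    (hx : T x ∈ (T.inversePMap hinj).domain) : T.inversePMap hinj ⟨T x, hx⟩ = x :=
  (LinearEquiv.ofInjective T hinj).symm_apply_apply x

/-- Let B = T⁻¹. For y in dom B*, ⟨B* y, T x⟩ = ⟨y, x⟩ for all x, so y = T (B* y) already lies in
the range of `T`. -/
theorem LinearMap.IsSymmetric.isSelfAdjoint_inversePMap {T : H →ₗ[ℂ] H} (hT : T.IsSymmetric)
    (hinj : Function.Injective T) : IsSelfAdjoint (T.inversePMap hinj) := by
  have hmem : ∀ x, T x ∈ (T.inversePMap hinj).domain := LinearMap.mem_range_self T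
  have hdense : Dense ((T.inversePMap hinj).domain : Set H) := hT.dense_range hinj
  have hformal : (T.inversePMap hinj).IsFormalAdjoint (T.inversePMap hinj) := by
    rintro ⟨_, x, rfl⟩ ⟨_, y, rfl⟩
    have hx := T.inversePMap_apply hinj x (hmem x)
    have hy := T.inversePMap_apply hinj y (hmem y)
    change inner ℂ (T.inversePMap hinj ⟨T x, hmem x⟩) (T y) =
      inner ℂ (T x) (T.inversePMap hinj ⟨T y, hmem y⟩)
    rw [hx, hy]
    exact (hT x y).symm
  have hle := hformal.le_adjoint hdense
  rw [LinearPMap.isSelfAdjoint_def]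
  refine (LinearPMap.eq_of_le_of_domain_eq hle (le_antisymm hle.1 fun y hy => ?_)).symm
  refine ⟨(T.inversePMap hinj).adjoint ⟨y, hy⟩, ?_⟩
  refine ext_inner_right ℂ fun x => ?_
  have h := LinearPMap.adjoint_isFormalAdjoint hdense ⟨y, hy⟩ ⟨T x, hmem x⟩
  rw [T.inversePMap_apply hinj x] at h
  rw [hT]
  exact h

end InverseOperators

/-! ### Diagonal operators with prescribed multiplicities -/

section DiagonalModel

open ContinuousLinearMap

variable {H : Type*} [NormedAddCommGroup H] [InnerProductSpace ℂ H] [CompleteSpace H]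

theorem HilbertBasis.isSymmetric_levelOp {ι : Type*} (e : HilbertBasis ι ℂ H) (lev : ι → ℕ) :
    (e.levelOp lev : H →ₗ[ℂ] H).IsSymmetric := fun x y => e.inner_levelOp_left lev x y

/-- The self-adjoint operator with `e i ↦ 2 ^ lev i • e i`. -/
noncomputable def HilbertBasis.levelSA {ι : Type*} (e : HilbertBasis ι ℂ H) (lev : ι → ℕ) : SA H :=
  ⟨(e.levelOp lev : H →ₗ[ℂ] H).inversePMap (e.levelOp_injective lev),
    (e.isSymmetric_levelOp lev).isSelfAdjoint_inversePMap _⟩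

theorem HilbertBasis.levelOp_self {ι : Type*} (e : HilbertBasis ι ℂ H) (lev : ι → ℕ) (i : ι) :
    e.levelOp lev ((2 ^ lev i : ℂ) • e i) = e i := by
  refine e.ext_inner fun j => ?_
  rw [e.inner_levelOp, inner_smul_right]
  rcases eq_or_ne j i with rfl | h
  · rw [← mul_assoc]
    push_cast
    rw [← mul_pow]
    norm_num
  · rw [e.orthonormal.2 h, mul_zero, mul_zero]

theorem HilbertBasis.resolvent_levelSA {ι : Type*} (e : HilbertBasis ι ℂ H) (lev : ι → ℕ) (i : ι) :
    (e.levelSA lev).resolvent (e i) = ((2 : ℂ) ^ lev i - I)⁻¹ • e i := by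
  have hne : (2 : ℂ) ^ lev i - I ≠ 0 := by
    intro h
    have := congrArg Complex.im h
    have h2 : ((2 : ℂ) ^ lev i).im = 0 := by
      rw [show (2 : ℂ) ^ lev i = ((2 ^ lev i : ℝ) : ℂ) by push_cast; rfl, Complex.ofReal_im]
    rw [Complex.sub_im, h2] at this
    simp at this
  have hmem : e i ∈ (e.levelSA lev).dom := ⟨_, e.levelOp_self lev i⟩
  have hA : (e.levelSA lev).1 ⟨e i, hmem⟩ = (2 ^ lev i : ℂ) • e i := by
    have h := (e.levelOp lev : H →ₗ[ℂ] H).inversePMap_apply (e.levelOp_injective lev)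
      ((2 ^ lev i : ℂ) • e i) ⟨_, rfl⟩
    rw [← h]
    congr 1
    exact Subtype.ext (e.levelOp_self lev i).symm
  have hsub : (e.levelSA lev).subI ⟨e i, hmem⟩ = ((2 : ℂ) ^ lev i - I) • e i := by
    rw [SA.subI_apply, sub_smul]
    exact congrArg (· - I • e i) hA
  have h := (e.levelSA lev).resolvent_subI ⟨e i, hmem⟩
  rw [hsub, map_smul] at h
  rw [eq_inv_smul_iff₀ hne]
  exact h

theorem HilbertBasis.exists_nat [TopologicalSpace.SeparableSpace H]
    (hH : ¬ FiniteDimensional ℂ H) : Nonempty (HilbertBasis ℕ ℂ H) := by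
  obtain ⟨w, b, -⟩ := exists_hilbertBasis ℂ H
  have := b.countable_index
  have := b.infinite_index hH
  obtain ⟨φ⟩ : Nonempty (ℕ ≃ w) := nonempty_equiv_of_countable
  exact ⟨HilbertBasis.mk (b.orthonormal.comp φ φ.injective) (by
    rw [φ.surjective.range_comp]
    exact b.dense_span.ge)⟩

/-- Resolvents are contractions, so testing on basis vectors suffices, and there the resolvent
depends only on one locally constant level. -/
theorem HilbertBasis.continuous_levelSA (e : HilbertBasis ℕ ℂ H) :
    Continuous fun a : SeqX₀ => e.levelSA a.1.level := by
  refine continuous_induced_rng.2 (stronglyContinuous_iff.1 ?_)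
  refine StronglyContinuous.of_hilbertBasis (fun a => SA.norm_resolvent_le _) e fun j => ?_
  simp only [e.resolvent_levelSA]
  rw [continuous_iff_continuousAt]
  intro a
  refine (continuousAt_const (y := ((2 : ℂ) ^ a.1.level j - I)⁻¹ • e j)).congr ?_
  filter_upwards [continuous_subtype_val.continuousAt.eventually (SeqX.eventually_level_eq a.2 j)]
    with b hb
  rw [hb]

theorem borelReducible_eDomU [TopologicalSpace.SeparableSpace H]
    (hH : ¬ FiniteDimensional ℂ H) : BorelReducible ESigma₀ (EDomU H) := by
  obtain ⟨e⟩ := HilbertBasis.exists_nat hH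
  refine ⟨fun a => e.levelSA a.1.level, ?_, fun a b => ?_⟩
  · let _ : MeasurableSpace SeqX₀ := borel _
    have : BorelSpace SeqX₀ := ⟨rfl⟩
    let _ : MeasurableSpace (SA H) := borel _
    have : BorelSpace (SA H) := ⟨rfl⟩
    exact e.continuous_levelSA.measurable
  · have h := e.exists_unitary_image_eq_iff e a.1.level b.1.level
    rw [SeqX.fiberCard_level a.2, SeqX.fiberCard_level b.2] at h
    -- The domain of the inverse is by definition the range of the level operator.
    exact h.symm

end DiagonalModel

/-! ### Reducibility -/

section Reducibility

theorem BorelReducible.trans {X Y Z : Type*} [TopologicalSpace X] [TopologicalSpace Y]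
    [TopologicalSpace Z] {E : X → X → Prop} {F : Y → Y → Prop} {G : Z → Z → Prop}
    (h : BorelReducible E F) (h' : BorelReducible F G) : BorelReducible E G := by
  obtain ⟨f, hf, hf'⟩ := h
  obtain ⟨g, hg, hg'⟩ := h'
  exact ⟨g ∘ f, @Measurable.comp _ _ _ (borel X) (borel Y) (borel Z) _ _ hg hf,
    fun x y => (hf' x y).trans (hg' _ _)⟩

theorem borelReducible_esigma₀_esigma : BorelReducible ESigma₀ ESigma :=
  ⟨Subtype.val, continuous_subtype_val.borel_measurable, fun _ _ => Iff.rfl⟩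

instance : PolishSpace ℕ∞ := ENat.isClosedEmbedding_toENNReal.polishSpace

end Reducibility

theorem proposition3p8 :
    IsKSigmaEquivalence ESigma ∧
    BorelReducible ESigma₀ ESigma ∧
    ∀ (H : Type*) [NormedAddCommGroup H] [InnerProductSpace ℂ H] [CompleteSpace H]
      [TopologicalSpace.SeparableSpace H], ¬ FiniteDimensional ℂ H →
      BorelBireducible (EDomU H) ESigma₀ ∧
      BorelReducible (EDomU H) ESigma ∧
      ∃ (Y : Type) (_ : TopologicalSpace Y) (_ : PolishSpace Y) (F : Y → Y → Prop),
        IsKSigmaEquivalence F ∧ BorelReducible (EDomU H) F := by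
  refine ⟨isKSigmaEquivalence_esigma, borelReducible_esigma₀_esigma, ?_⟩
  intro H _ _ _ _ hH
  have h1 := SA.borelReducible_esigma₀ hH
  have h2 := h1.trans borelReducible_esigma₀_esigma
  exact ⟨⟨h1, borelReducible_eDomU hH⟩, h2,
    SeqX, inferInstance, inferInstance, ESigma, isKSigmaEquivalence_esigma, h2⟩
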